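/- Let $d\ge 1$. For $\gamma\in(0,1]$ and $a>0$, a (Lebesgue) measurable set $\omega\subset\mathbb{R}^d$ is called $(\gamma,a)$-thick if $|\omega\cap(x+[0,a]^d)|\ge \gamma a^d$ for every $x\in\mathbb{R}^d$. The Fourier transform on $L^2(\mathbb{R}^d;\mathbb{C})$ is normalised by $\widehat f(\xi)=\int_{\mathbb{R}^d} f(x)e^{-ix\cdot\xi}\,\mathrm{d}x$ (for $f \in L^1\cap L^2$, extended by continuity), and $B(0,N)=\{\xi\in\mathbb{R}^d : |\xi|\le N\}$. There exists a constant $C>0$, depending only on the dimension $d$, such that for all $\gamma\in(0,1]$ and $a>0$, every $(\gamma,a)$-thick measurable set $\omega\subset\mathbb{R}^d$, every $N\ge 0$, and every $f\in L^2(\mathbb{R}^d;\mathbb{C})$ with $\operatorname{supp}\widehat f\subset B(0,N)$, one has $$\|f\|_{L^2(\mathbb{R}^d)}\le\left(\frac{C}{\gamma}\right)^{C(Na+1)}\|f\|_{L^2(\omega)}.$$ -/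

import Mathlib

open MeasureTheory FourierTransform Topology

namespace LogvinenkoSereda

/-- The closed axis-parallel cube `x + [0,a]^d`. -/
def cube {d : ℕ} (x : EuclideanSpace ℝ (Fin d)) (a : ℝ) : Set (EuclideanSpace ℝ (Fin d)) :=
  {y | ∀ i, y i ∈ Set.Icc (x i) (x i + a)}

/-- `ω` is `(γ,a)`-thick: `|ω ∩ (x + [0,a]^d)| ≥ γ a^d` for every `x`. Measurability of `ω` and
the ranges of `γ` and `a` are kept as separate hypotheses. -/
def IsThick {d : ℕ} (γ a : ℝ) (ω : Set (EuclideanSpace ℝ (Fin d))) : Prop :=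
  ∀ x : EuclideanSpace ℝ (Fin d), ENNReal.ofReal (γ * a ^ d) ≤ volume (ω ∩ cube x a)

/-- The Fourier transform on `L²(ℝ^d; ℂ)` in the normalisation `∫ f(x) e^{-i x·ξ} dx`
(for `f ∈ L¹ ∩ L²`). Mathlib's `𝓕` has the kernel `e^{-2π i x·ξ}`, so it is evaluated
at `ξ / (2π)`. -/
noncomputable def fourierHat {d : ℕ}
    (f : Lp ℂ 2 (volume : Measure (EuclideanSpace ℝ (Fin d)))) :
    EuclideanSpace ℝ (Fin d) → ℂ :=
  fun ξ => (𝓕 f : Lp ℂ 2 (volume : Measure (EuclideanSpace ℝ (Fin d)))) ((2 * Real.pi)⁻¹ • ξ)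

/-- The support of (the a.e. class of) `g`: the points no neighbourhood of which `g` vanishes
almost everywhere on. -/
def essSupport {d : ℕ} (g : EuclideanSpace ℝ (Fin d) → ℂ) : Set (EuclideanSpace ℝ (Fin d)) :=
  {ξ | ∀ U ∈ 𝓝 ξ, volume {η ∈ U | g η ≠ 0} ≠ 0}

end LogvinenkoSereda

/-!
Let `f = 𝓕⁻ g` with `g` supported in the ball of radius `r`. On a line through `x`, `f` is a
superposition of exponentials `exp (i λ t)` with bounded `λ`, so Lagrange interpolation at `n + 1`
nodes extrapolates it to `x` with an error that decays factorially in `n`. A set of measure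
proportional to that of the cube meets some line through `x` in a set of proportional length, and
`n + 1` separated nodes chosen there give total weight at most `(C / γ) ^ n`; keeping only the
points where `|f|²` is at most twice its average turns this into a bound for `|f x|²` by the mean of
`|f|²` over the observed set.

The error involves the `L²` norm of `f` over the whole space, so `f` is first multiplied by a
band-limited weight `𝓕⁻ (window φ)` that is bounded below on the cube and square integrable.
Integrating the resulting local estimate over all translates of the cube, the error term becomes a
factorially small multiple of `‖f‖²`, which is absorbed as soon as `n` exceeds a fixed multiple of
`N a + 1`.
-/

namespace LogvinenkoSereda

section Interpolation

open Polynomial Lagrange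

theorem exists_iteratedDeriv_eq_zero_of_strictMono (n : ℕ) {f : ℝ → ℝ} (hf : ContDiff ℝ n f)
    {z : Fin (n + 1) → ℝ} (hz : StrictMono z) (hfz : ∀ i, f (z i) = 0) :
    ∃ x, iteratedDeriv n f x = 0 := by
  induction n generalizing f with
  | zero => exact ⟨z 0, by simpa using hfz 0⟩
  | succ n ih =>
    have hrolle (i : Fin (n + 1)) : ∃ c ∈ Set.Ioo (z i.castSucc) (z i.succ), deriv f c = 0 :=
      exists_deriv_eq_zero (hz i.castSucc_lt_succ) hf.continuous.continuousOn
        ((hfz _).trans (hfz _).symm)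
    choose c hc hfc using hrolle
    have hc_mono : StrictMono c := Fin.strictMono_iff_lt_succ.2 fun i =>
      ((hc i.castSucc).2.trans_eq (congrArg z (Fin.succ_castSucc i))).trans (hc i.succ).1
    rw [iteratedDeriv_succ']
    exact ih hf.deriv' hc_mono hfc

theorem exists_iteratedDeriv_eq_zero {n : ℕ} {f : ℝ → ℝ} (hf : ContDiff ℝ n f) {s : Finset ℝ}
    (hs : n < s.card) (hfs : ∀ x ∈ s, f x = 0) : ∃ x, iteratedDeriv n f x = 0 := by
  obtain ⟨t, hts, ht⟩ := Finset.exists_subset_card_eq (Nat.succ_le_of_lt hs)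
  exact exists_iteratedDeriv_eq_zero_of_strictMono n hf (t.orderEmbOfFin ht).strictMono
    fun i => hfs _ (hts (t.orderEmbOfFin_mem ht i))

theorem iteratedDeriv_polynomial_eval (P : ℝ[X]) (n : ℕ) :
    iteratedDeriv n (fun x => P.eval x) = fun x => (derivative^[n] P).eval x := by
  induction n generalizing P with
  | zero => simp
  | succ n ih =>
    have hderiv : deriv (fun x => P.eval x) = fun x => P.derivative.eval x :=
      funext fun x => P.deriv
    rw [iteratedDeriv_succ', hderiv, ih, Function.iterate_succ_apply]

theorem iterate_derivative_natDegree {R : Type*} [CommSemiring R] {P : R[X]} (hP : P.Monic) :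
    derivative^[P.natDegree] P = C (P.natDegree.factorial : R) := by
  ext k
  rw [coeff_iterate_derivative, coeff_C]
  rcases Nat.eq_zero_or_pos k with rfl | hk
  · simp [Nat.descFactorial_self, hP.coeff_natDegree]
  · rw [if_neg hk.ne', coeff_eq_zero_of_natDegree_lt (by lia), smul_zero]

variable {ι : Type*} [DecidableEq ι] {s : Finset ι} {v : ι → ℝ}

theorem exists_sub_eval_interpolate_eq (hv : Set.InjOn v s) {f : ℝ → ℝ}
    (hf : ContDiff ℝ s.card f) (x : ℝ) :
    ∃ ξ, f x - (interpolate s v (f ∘ v)).eval x =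
      iteratedDeriv s.card f ξ / s.card.factorial * (nodal s v).eval x := by
  set P := interpolate s v (f ∘ v)
  have hP (i) (hi : i ∈ s) : P.eval (v i) = f (v i) := eval_interpolate_at_node _ hv hi
  by_cases hx : ∃ i ∈ s, v i = x
  · obtain ⟨i, hi, rfl⟩ := hx
    exact ⟨0, by rw [hP i hi, eval_nodal_at_node hi, sub_self, mul_zero]⟩
  have hx0 : (nodal s v).eval x ≠ 0 :=
    eval_nodal_not_at_node fun i hi h => hx ⟨i, hi, h.symm⟩
  set κ := (f x - P.eval x) / (nodal s v).eval x with hκ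
  set Q := P + C κ * nodal s v with hQ
  have hzero : ∀ t ∈ insert x (s.image v), f t - Q.eval t = 0 := by
    simp only [Finset.forall_mem_insert, Finset.forall_mem_image]
    refine ⟨by simp [hQ, hκ, hx0], fun i hi => ?_⟩
    simp [hQ, hP i hi, eval_nodal_at_node hi]
  have hcard : s.card < (insert x (s.image v)).card := by
    rw [Finset.card_insert_of_notMem (by simpa using hx), Finset.card_image_of_injOn hv]
    exact Nat.lt_succ_self _
  have hQ_contDiff : ContDiff ℝ s.card fun t => Q.eval t := by
    simpa using Q.contDiff_aeval (𝕜 := ℝ) s.card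
  obtain ⟨ξ, hξ⟩ := exists_iteratedDeriv_eq_zero (hf.sub hQ_contDiff) hcard hzero
  have hQ_deriv : derivative^[s.card] Q = C (κ * s.card.factorial) := by
    have hP_deriv : derivative^[s.card] P = 0 :=
      iterate_derivative_eq_zero_of_degree_lt (degree_interpolate_lt _ hv)
    have hnodal : derivative^[s.card] (nodal s v) = C (s.card.factorial : ℝ) := by
      simpa using iterate_derivative_natDegree (nodal_monic (s := s) (v := v))
    rw [hQ, iterate_map_add, hP_deriv, iterate_derivative_C_mul, hnodal, zero_add, ← C_mul]
  have hfξ : iteratedDeriv s.card f ξ = κ * s.card.factorial := by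
    rw [iteratedDeriv_fun_sub hf.contDiffAt hQ_contDiff.contDiffAt, iteratedDeriv_polynomial_eval,
      hQ_deriv] at hξ
    simpa only [eval_C, sub_eq_zero] using hξ
  exact ⟨ξ, by rw [hfξ, mul_div_cancel_right₀ _ (by positivity), hκ, div_mul_cancel₀ _ hx0]⟩

theorem iteratedDeriv_clm_comp {E F : Type*} [NormedAddCommGroup E] [NormedSpace ℝ E]
    [NormedAddCommGroup F] [NormedSpace ℝ F] (L : E →L[ℝ] F) {f : ℝ → E} {n : ℕ}
    (hf : ContDiff ℝ n f) (x : ℝ) :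
    iteratedDeriv n (fun t => L (f t)) x = L (iteratedDeriv n f x) := by
  have h := L.iteratedFDeriv_comp_left hf.contDiffAt (x := x) (le_refl (n : WithTop ℕ∞))
  exact congrArg (fun M => M fun _ => 1) h

theorem norm_sub_sum_basis_smul_le {E : Type*} [NormedAddCommGroup E] [NormedSpace ℝ E]
    (hv : Set.InjOn v s) {f : ℝ → E} (hf : ContDiff ℝ s.card f) {K : ℝ}
    (hK : ∀ t, ‖iteratedDeriv s.card f t‖ ≤ K) (x : ℝ) :
    ‖f x - ∑ i ∈ s, (Lagrange.basis s v i).eval x • f (v i)‖ ≤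
      K / s.card.factorial * |(nodal s v).eval x| := by
  obtain ⟨L, hL, hLf⟩ :=
    exists_dual_vector'' ℝ (f x - ∑ i ∈ s, (Lagrange.basis s v i).eval x • f (v i))
  obtain ⟨ξ, hξ⟩ := exists_sub_eval_interpolate_eq hv (L.contDiff.comp hf) x
  have hLK : |iteratedDeriv s.card (L ∘ f) ξ| ≤ K := by
    rw [Function.comp_def, iteratedDeriv_clm_comp L hf, ← Real.norm_eq_abs]
    exact (L.le_of_opNorm_le hL _).trans ((one_mul _).trans_le (hK ξ))
  calc ‖f x - ∑ i ∈ s, (Lagrange.basis s v i).eval x • f (v i)‖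
      = (L ∘ f) x - (interpolate s v ((L ∘ f) ∘ v)).eval x := by
        simpa [interpolate_apply, Polynomial.eval_finsetSum, mul_comm] using hLf.symm
    _ = iteratedDeriv s.card (L ∘ f) ξ / s.card.factorial * (nodal s v).eval x := hξ
    _ ≤ |iteratedDeriv s.card (L ∘ f) ξ / s.card.factorial * (nodal s v).eval x| := le_abs_self _
    _ ≤ K / s.card.factorial * |(nodal s v).eval x| := by
        rw [abs_mul, abs_div, Nat.abs_cast]
        gcongr

theorem iteratedDeriv_exp_ofReal_mul_I (s : ℝ) (n : ℕ) :
    iteratedDeriv n (fun t : ℝ => Complex.exp ((s * t : ℝ) * Complex.I)) =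
      fun t => (s * Complex.I) ^ n * Complex.exp ((s * t : ℝ) * Complex.I) := by
  induction n with
  | zero => simp
  | succ n ih =>
    ext t
    have hlin : HasDerivAt (fun t : ℝ => ((s * t : ℝ) : ℂ) * Complex.I) (s * Complex.I) t := by
      simpa using (((hasDerivAt_id t).const_mul s).ofReal_comp).mul_const Complex.I
    rw [iteratedDeriv_succ, ih, (hlin.cexp.const_mul _).deriv]
    ring

theorem norm_exp_sub_sum_basis_mul_exp_le (hv : Set.InjOn v s) (a x : ℝ) :
    ‖Complex.exp ((a * x : ℝ) * Complex.I) - ∑ i ∈ s, (((Lagrange.basis s v i).eval x : ℝ) : ℂ) *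
      Complex.exp ((a * v i : ℝ) * Complex.I)‖ ≤
      |a| ^ s.card / s.card.factorial * |(nodal s v).eval x| := by
  have hf : ContDiff ℝ s.card fun t : ℝ => Complex.exp ((a * t : ℝ) * Complex.I) :=
    ((Complex.ofRealCLM.contDiff.comp (contDiff_const.mul contDiff_id)).mul contDiff_const).cexp
  simpa only [Complex.real_smul] using norm_sub_sum_basis_smul_le hv hf (K := |a| ^ s.card)
    (fun t => by
      rw [iteratedDeriv_exp_ofReal_mul_I, norm_mul, Complex.norm_exp_ofReal_mul_I, norm_pow,
        norm_mul, Complex.norm_I, Complex.norm_real, mul_one, mul_one, Real.norm_eq_abs]) x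

end Interpolation

section SeparatedNodes

theorem exists_separated_points {δ : ℝ} (hδ : 0 < δ) (n : ℕ) {T : Set ℝ} (hT : BddBelow T)
    (hvol : ENNReal.ofReal (2 * n * δ) < volume T) :
    ∃ v : ℕ → ℝ, (∀ i ≤ n, v i ∈ T) ∧ ∀ i < n, v i + δ ≤ v (i + 1) := by
  have hne : T.Nonempty := nonempty_of_measure_ne_zero (bot_le.trans_lt hvol).ne'
  induction n generalizing T with
  | zero =>
    obtain ⟨x, hx⟩ := hne
    exact ⟨fun _ => x, fun _ _ => hx, by simp⟩
  | succ n ih =>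
    obtain ⟨x, hx, hxT⟩ := exists_lt_of_csInf_lt hne (lt_add_of_pos_right (sInf T) hδ)
    have hcover : T ⊆ Set.Icc (sInf T) (sInf T + 2 * δ) ∪ (T ∩ Set.Ici (x + δ)) := by
      intro y hy
      by_cases h : x + δ ≤ y
      · exact Or.inr ⟨hy, h⟩
      · exact Or.inl ⟨csInf_le hT hy, by linarith⟩
    have hvol' : ENNReal.ofReal (2 * n * δ) < volume (T ∩ Set.Ici (x + δ)) := by
      have h := hvol.trans_le ((measure_mono hcover).trans (measure_union_le _ _))
      rw [Real.volume_Icc, add_sub_cancel_left, Nat.cast_add_one,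
        show 2 * ((n : ℝ) + 1) * δ = 2 * δ + 2 * n * δ by ring,
        ENNReal.ofReal_add (by positivity) (by positivity)] at h
      exact lt_of_add_lt_add_left h
    obtain ⟨v, hv, hgap⟩ := ih (hT.mono Set.inter_subset_left) hvol'
      (nonempty_of_measure_ne_zero (bot_le.trans_lt hvol').ne')
    refine ⟨fun i => i.casesOn x v, fun i hi => ?_, fun i hi => ?_⟩
    · cases i with
      | zero => exact hx
      | succ i => exact (hv i (by lia)).1
    · cases i with
      | zero => exact (hv 0 n.zero_le).2
      | succ i => exact hgap i (by lia)

theorem mul_abs_sub_le_of_forall_add_le {δ : ℝ} {n : ℕ} {v : ℕ → ℝ}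
    (hv : ∀ i < n, v i + δ ≤ v (i + 1)) {i k : ℕ} (hi : i ≤ n) (hk : k ≤ n) :
    δ * |(i : ℝ) - k| ≤ |v i - v k| := by
  wlog hik : i ≤ k generalizing i k
  · rw [abs_sub_comm, abs_sub_comm (v i)]
    exact this hk hi (le_of_not_ge hik)
  have hgap : v i + δ * (k - i) ≤ v k := by
    induction k, hik using Nat.le_induction with
    | base => simp
    | succ k _ ih =>
      have := ih (by lia)
      have := hv k (by lia)
      push_cast
      linarith
  have hcast : (i : ℝ) ≤ k := by exact_mod_cast hik
  rw [abs_sub_comm, abs_of_nonneg (sub_nonneg.2 hcast), abs_sub_comm]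
  exact (by linarith : δ * ((k : ℝ) - i) ≤ v k - v i).trans (le_abs_self _)

theorem prod_erase_range_abs_sub {n j : ℕ} (hj : j ≤ n) :
    ∏ k ∈ (Finset.range (n + 1)).erase j, |(j : ℝ) - k| = j.factorial * (n - j).factorial := by
  induction n, hj using Nat.le_induction with
  | base =>
    have hprod : ∏ k ∈ Finset.range j, |(j : ℝ) - k| =
        ((∏ k ∈ Finset.range j, (j - k) : ℕ) : ℝ) := by
      rw [Nat.cast_prod]
      refine Finset.prod_congr rfl fun k hk => ?_
      have hkj := (Finset.mem_range.1 hk).le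
      rw [Nat.cast_sub hkj, abs_of_nonneg (sub_nonneg.2 (by exact_mod_cast hkj))]
    rw [Finset.range_add_one, Finset.erase_insert Finset.notMem_range_self, hprod,
      ← Nat.descFactorial_eq_prod_range, Nat.descFactorial_self, Nat.sub_self,
      Nat.factorial_zero, Nat.cast_one, mul_one]
  | succ n hj ih =>
    have hjn : j ≠ n + 1 := by lia
    have habs : |(j : ℝ) - (n + 1 : ℕ)| = (n - j + 1 : ℕ) := by
      have : (j : ℝ) ≤ n := by exact_mod_cast hj
      push_cast [Nat.cast_sub hj]
      rw [abs_sub_comm, abs_of_nonneg (by linarith)]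
      ring
    rw [Finset.range_add_one, Finset.erase_insert_of_ne hjn.symm,
      Finset.prod_insert (by simp), ih, habs, Nat.succ_sub hj, Nat.factorial_succ]
    push_cast
    ring

variable {n : ℕ} {v : ℕ → ℝ} {δ : ℝ}

theorem injOn_range_of_mul_abs_sub_le (hδ : 0 < δ)
    (hv : ∀ i ≤ n, ∀ k ≤ n, δ * |(i : ℝ) - k| ≤ |v i - v k|) :
    Set.InjOn v (Finset.range (n + 1)) := by
  intro i hi k hk hik
  have h := hv i (by simpa using hi) k (by simpa using hk)
  rw [hik, sub_self, abs_zero] at h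
  have : |(i : ℝ) - k| = 0 := le_antisymm (by nlinarith [abs_nonneg ((i : ℝ) - k)]) (abs_nonneg _)
  exact_mod_cast sub_eq_zero.1 (abs_eq_zero.1 this)

theorem abs_eval_basis_zero_le (hδ : 0 < δ) (hv1 : ∀ i ≤ n, |v i| ≤ 1)
    (hv : ∀ i ≤ n, ∀ k ≤ n, δ * |(i : ℝ) - k| ≤ |v i - v k|) {j : ℕ} (hj : j ≤ n) :
    |(Lagrange.basis (Finset.range (n + 1)) v j).eval 0| ≤
      n.choose j / (δ ^ n * n.factorial) := by
  set s := (Finset.range (n + 1)).erase j with hs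
  have hcard : s.card = n := by
    rw [hs, Finset.card_erase_of_mem (by simpa [Nat.lt_succ_iff] using hj), Finset.card_range,
      Nat.add_sub_cancel]
  have hfactor (k) (hk : k ∈ s) :
      |(Lagrange.basisDivisor (v j) (v k)).eval 0| ≤ (δ * |(j : ℝ) - k|)⁻¹ := by
    obtain ⟨hkj, hkn⟩ : k ≠ j ∧ k < n + 1 := by simpa [hs] using hk
    have hpos : 0 < |(j : ℝ) - k| := abs_pos.2 (sub_ne_zero.2 (by exact_mod_cast hkj.symm))
    have heval : (Lagrange.basisDivisor (v j) (v k)).eval 0 = (v j - v k)⁻¹ * -v k := by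
      simp [Lagrange.basisDivisor]
    rw [heval, abs_mul, abs_inv, abs_neg]
    exact (mul_le_of_le_one_right (by positivity) (hv1 k (by lia))).trans
      (inv_anti₀ (by positivity) (hv j hj k (by lia)))
  have hchoose : (n.choose j : ℝ) * (j.factorial * (n - j).factorial) = n.factorial := by
    rw [← mul_assoc]
    exact_mod_cast Nat.choose_mul_factorial_mul_factorial hj
  calc |(Lagrange.basis (Finset.range (n + 1)) v j).eval 0|
      = ∏ k ∈ s, |(Lagrange.basisDivisor (v j) (v k)).eval 0| := by
        rw [Lagrange.basis, Polynomial.eval_prod, Finset.abs_prod]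
    _ ≤ ∏ k ∈ s, (δ * |(j : ℝ) - k|)⁻¹ := Finset.prod_le_prod (fun _ _ => abs_nonneg _) hfactor
    _ = (δ ^ n * (j.factorial * (n - j).factorial))⁻¹ := by
        rw [Finset.prod_inv_distrib, Finset.prod_mul_distrib, Finset.prod_const, hcard,
          prod_erase_range_abs_sub hj]
    _ = n.choose j / (δ ^ n * n.factorial) := by
        have : (n.choose j : ℝ) ≠ 0 := by exact_mod_cast (Nat.choose_pos hj).ne'
        rw [← hchoose]
        field_simp

theorem sum_abs_eval_basis_zero_le (hδ : 0 < δ) (hv1 : ∀ i ≤ n, |v i| ≤ 1)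
    (hv : ∀ i ≤ n, ∀ k ≤ n, δ * |(i : ℝ) - k| ≤ |v i - v k|) :
    ∑ j ∈ Finset.range (n + 1), |(Lagrange.basis (Finset.range (n + 1)) v j).eval 0| ≤
      (2 / δ) ^ n / n.factorial := by
  calc ∑ j ∈ Finset.range (n + 1), |(Lagrange.basis (Finset.range (n + 1)) v j).eval 0|
      ≤ ∑ j ∈ Finset.range (n + 1), n.choose j / (δ ^ n * n.factorial) :=
        Finset.sum_le_sum fun j hj =>
          abs_eval_basis_zero_le hδ hv1 hv (Nat.lt_succ_iff.1 (Finset.mem_range.1 hj))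
    _ = (2 / δ) ^ n / n.factorial := by
        rw [← Finset.sum_div, ← Nat.cast_sum, Nat.sum_range_choose, div_pow, div_div]
        norm_num

theorem norm_one_sub_sum_basis_mul_exp_le (hv1 : ∀ i ≤ n, |v i| ≤ 1)
    (hv : Set.InjOn v (Finset.range (n + 1))) (a : ℝ) :
    ‖1 - ∑ j ∈ Finset.range (n + 1),
      (((Lagrange.basis (Finset.range (n + 1)) v j).eval 0 : ℝ) : ℂ) *
        Complex.exp ((a * v j : ℝ) * Complex.I)‖ ≤ |a| ^ (n + 1) / (n + 1).factorial := by
  have hnodal : |(Lagrange.nodal (Finset.range (n + 1)) v).eval 0| ≤ 1 := by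
    rw [Lagrange.eval_nodal, Finset.abs_prod]
    refine Finset.prod_le_one (fun _ _ => abs_nonneg _) fun i hi => ?_
    rw [zero_sub, abs_neg]
    exact hv1 i (Nat.lt_succ_iff.1 (Finset.mem_range.1 hi))
  have h := norm_exp_sub_sum_basis_mul_exp_le hv a 0
  rw [mul_zero, Complex.ofReal_zero, zero_mul, Complex.exp_zero, Finset.card_range] at h
  exact h.trans (mul_le_of_le_one_right (by positivity) hnodal)

theorem exists_nodes_weights (n : ℕ) {T : Set ℝ} (hT : T ⊆ Set.Icc (-1) 1) {τ : ℝ} (hτ : 0 < τ)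
    (hvol : ENNReal.ofReal τ ≤ volume T) :
    ∃ v c : ℕ → ℝ, (∀ i ≤ n, v i ∈ T) ∧
      (∑ j ∈ Finset.range (n + 1), |c j| ≤ Real.exp 1 * (4 * Real.exp 1 / τ) ^ n) ∧
      ∀ a : ℝ, ‖1 - ∑ j ∈ Finset.range (n + 1),
        (c j : ℂ) * Complex.exp ((a * v j : ℝ) * Complex.I)‖ ≤
          |a| ^ (n + 1) / (n + 1).factorial := by
  set δ := τ / (2 * (n + 1)) with hδ_def
  have hδ : 0 < δ := by positivity
  have hδτ : 2 * n * δ < τ := by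
    have : 2 * (n + 1) * δ = τ := by rw [hδ_def]; field_simp
    linarith
  obtain ⟨v, hvT, hgap⟩ := exists_separated_points hδ n (bddBelow_Icc.mono hT)
    (((ENNReal.ofReal_lt_ofReal_iff hτ).2 hδτ).trans_le hvol)
  have hv1 (i) (hi : i ≤ n) : |v i| ≤ 1 := abs_le.2 (hT (hvT i hi))
  have hv (i) (hi : i ≤ n) (k) (hk : k ≤ n) : δ * |(i : ℝ) - k| ≤ |v i - v k| :=
    mul_abs_sub_le_of_forall_add_le hgap hi hk
  refine ⟨v, fun j => (Lagrange.basis (Finset.range (n + 1)) v j).eval 0, hvT, ?_,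
    norm_one_sub_sum_basis_mul_exp_le hv1 (injOn_range_of_mul_abs_sub_le hδ hv)⟩
  calc ∑ j ∈ Finset.range (n + 1), |(Lagrange.basis (Finset.range (n + 1)) v j).eval 0|
      ≤ (2 / δ) ^ n / n.factorial := sum_abs_eval_basis_zero_le hδ hv1 hv
    _ = (4 / τ) ^ n * ((n + 1 : ℝ) ^ n / n.factorial) := by
        rw [hδ_def, show 2 / (τ / (2 * ((n : ℝ) + 1))) = 4 / τ * (n + 1) by field_simp; norm_num,
          mul_pow, mul_div_assoc]
    _ ≤ (4 / τ) ^ n * Real.exp (n + 1) := by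
        gcongr
        exact Real.pow_div_factorial_le_exp (x := n + 1) (by positivity) n
    _ = Real.exp 1 * (4 * Real.exp 1 / τ) ^ n := by
        rw [Real.exp_add, ← Real.exp_one_pow n, div_pow, div_pow, mul_pow]
        ring

end SeparatedNodes

section Direction

variable {V : Type*} [NormedAddCommGroup V] [NormedSpace ℝ V] [FiniteDimensional ℝ V]
  [MeasurableSpace V] [BorelSpace V] (μ : Measure V) [μ.IsAddHaarMeasure]

theorem measure_le_measure_preimage_add_smul (E : Set V) (x : V) {t : ℝ} (ht0 : 0 < t)
    (ht1 : t ≤ 1) : μ E ≤ μ ((fun y => x + t • y) ⁻¹' E) := by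
  have hpre : (fun y => x + t • y) ⁻¹' E = (t • ·) ⁻¹' ((x + ·) ⁻¹' E) := rfl
  rw [hpre, Measure.addHaar_preimage_smul μ ht0.ne', measure_preimage_add]
  refine le_mul_of_one_le_left' ?_
  rw [ENNReal.one_le_ofReal, abs_inv, abs_of_pos (pow_pos ht0 _)]
  exact (one_le_inv₀ (pow_pos ht0 _)).2 (pow_le_one₀ ht0.le ht1)

variable {E : Set V} {x : V} {ϱ : ℝ}

theorem half_measure_le_setLIntegral_volume_line (hE : MeasurableSet E)
    (hEx : E ⊆ Metric.closedBall x ϱ) :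
    μ E / 2 ≤ ∫⁻ y in Metric.closedBall (0 : V) (2 * ϱ),
      volume ((fun t : ℝ => x + t • y) ⁻¹' E ∩ Set.Icc (1 / 2) 1) ∂μ := by
  set B := Metric.closedBall (0 : V) (2 * ϱ)
  set I : Set ℝ := Set.Icc (1 / 2) 1
  set S : Set (V × ℝ) := {q | x + q.2 • q.1 ∈ E}
  have hline : Measurable fun q : V × ℝ => x + q.2 • q.1 := by fun_prop
  have hS : MeasurableSet S := hline hE
  have hslice {t : ℝ} (ht : t ∈ I) : μ E ≤ μ.restrict B ((fun y => (y, t)) ⁻¹' S) := by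
    have ht0 : 0 < t := by linarith [ht.1]
    have hsub : (fun y => x + t • y) ⁻¹' E ⊆ B := fun y hy => by
      have hty : t * ‖y‖ ≤ ϱ := by simpa [norm_smul, abs_of_pos ht0] using hEx hy
      exact mem_closedBall_zero_iff.2 (by nlinarith [ht.1, norm_nonneg y])
    rw [Measure.restrict_apply (measurable_prodMk_right hS)]
    exact (measure_le_measure_preimage_add_smul μ E x ht0 ht.2).trans_eq
      (congrArg μ (Set.inter_eq_left.2 hsub).symm)
  calc μ E / 2 = ∫⁻ _ in I, μ E := by
        rw [setLIntegral_const, Real.volume_Icc, div_eq_mul_inv, sub_self_div_two, one_div,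
          ENNReal.ofReal_inv_of_pos two_pos, ENNReal.ofReal_ofNat]
    _ ≤ ∫⁻ t in I, μ.restrict B ((fun y => (y, t)) ⁻¹' S) :=
        setLIntegral_mono' measurableSet_Icc fun t ht => hslice ht
    _ = ∫⁻ y in B, volume.restrict I (Prod.mk y ⁻¹' S) ∂μ := by
        rw [← Measure.prod_apply_symm hS, Measure.prod_apply hS]
    _ = ∫⁻ y in B, volume ((fun t : ℝ => x + t • y) ⁻¹' E ∩ I) ∂μ :=
        lintegral_congr fun y => Measure.restrict_apply (measurable_prodMk_left hS)

theorem exists_measure_div_le_volume_line (hE : MeasurableSet E)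
    (hEx : E ⊆ Metric.closedBall x ϱ) (hE0 : μ E ≠ 0) :
    ∃ y ∈ Metric.closedBall (0 : V) (2 * ϱ),
      μ E / (2 * μ (Metric.closedBall (0 : V) (2 * ϱ))) ≤
        volume ((fun t : ℝ => x + t • y) ⁻¹' E ∩ Set.Icc (1 / 2) 1) := by
  have hint := half_measure_le_setLIntegral_volume_line μ hE hEx
  set B := Metric.closedBall (0 : V) (2 * ϱ)
  set F : V → ENNReal := fun y => volume ((fun t : ℝ => x + t • y) ⁻¹' E ∩ Set.Icc (1 / 2) 1)
  have hB0 : μ B ≠ 0 := fun h => by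
    rw [Measure.restrict_zero_set h, lintegral_zero_measure, nonpos_iff_eq_zero] at hint
    exact hE0 ((ENNReal.div_eq_zero_iff.1 hint).resolve_right ENNReal.ofNat_ne_top)
  have hF_le (y : V) : F y ≤ 1 := (measure_mono Set.inter_subset_right).trans <| by
    rw [Real.volume_Icc, ENNReal.ofReal_le_one]
    norm_num
  have hF_top : ∫⁻ y in B, F y ∂μ ≠ ⊤ := by
    have hB_top : μ B ≠ ⊤ := measure_closedBall_lt_top.ne
    refine ne_top_of_le_ne_top hB_top ((lintegral_mono hF_le).trans_eq ?_)
    rw [setLIntegral_const, one_mul]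
  obtain ⟨y, hy, hFy⟩ := exists_setLAverage_le hB0 measurableSet_closedBall.nullMeasurableSet hF_top
  refine ⟨y, hy, le_trans ?_ hFy⟩
  calc μ E / (2 * μ B) = μ E / 2 / μ B := by
        rw [div_eq_mul_inv, div_eq_mul_inv, div_eq_mul_inv,
          ENNReal.mul_inv (.inl two_ne_zero) (.inl ENNReal.ofNat_ne_top), mul_assoc]
    _ ≤ (∫⁻ y in B, F y ∂μ) / μ B := by gcongr
    _ = ⨍⁻ y in B, F y ∂μ := (setLAverage_eq μ F B).symm

end Direction

section Averages

variable {α : Type*} [MeasurableSpace α] {μ : Measure α}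

theorem sq_setIntegral_le {s : Set α} (hs : μ s ≠ ⊤) {f : α → ℝ} (hf : IntegrableOn f s μ)
    (hf2 : IntegrableOn (fun x => f x ^ 2) s μ) :
    (∫ x in s, f x ∂μ) ^ 2 ≤ μ.real s * ∫ x in s, f x ^ 2 ∂μ := by
  rcases eq_or_ne (μ s) 0 with hs0 | hs0
  · rw [setIntegral_measure_zero f hs0]
    simp [measureReal_def, hs0]
  have hpos : 0 < μ.real s := ENNReal.toReal_pos hs0 hs
  have hjensen := (even_two.convexOn_pow (𝕜 := ℝ)).map_set_average_le
    (continuous_pow 2).continuousOn isClosed_univ hs0 hs (by simp) hf hf2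
  rw [setAverage_eq, setAverage_eq, smul_eq_mul, smul_eq_mul, mul_pow] at hjensen
  field_simp at hjensen
  simpa using hjensen

theorem half_measureReal_le_measureReal_le_two_mul_average [IsFiniteMeasure μ] {f : α → ℝ}
    (hf0 : 0 ≤ f) (hf : Integrable f μ) :
    μ.real Set.univ / 2 ≤ μ.real {x | f x ≤ 2 * ⨍ x, f x ∂μ} := by
  set A := ⨍ x, f x ∂μ with hA
  have hA_mul : μ.real Set.univ * A = ∫ x, f x ∂μ := measure_smul_average μ f
  have hA0 : 0 ≤ A := by
    rw [hA, average_eq]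
    exact smul_nonneg (by positivity) (integral_nonneg hf0)
  rcases hA0.eq_or_lt with hA0 | hA0
  · rw [← hA0, mul_zero, eq_comm, integral_eq_zero_iff_of_nonneg hf0 hf] at hA_mul
    have hfull : {x | f x ≤ 2 * A} =ᵐ[μ] Set.univ :=
      Filter.eventuallyEq_univ.2 (hA_mul.mono fun x hx => by simp [hx, hA0.symm])
    rw [measureReal_congr hfull]
    exact half_le_self measureReal_nonneg
  · have hmarkov := mul_meas_ge_le_integral_of_nonneg (.of_forall hf0) hf (2 * A)
    have hunion : μ.real Set.univ ≤ μ.real {x | f x ≤ 2 * A} + μ.real {x | 2 * A ≤ f x} :=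
      (measureReal_mono fun x _ => le_total (f x) (2 * A)).trans (measureReal_union_le _ _)
    have : μ.real {x | 2 * A ≤ f x} ≤ μ.real Set.univ / 2 := by
      rw [← hA_mul] at hmarkov
      nlinarith
    linarith

theorem exists_subset_forall_le_two_mul_setAverage {s : Set α} (hs : MeasurableSet s)
    (hs_top : μ s ≠ ⊤) {f : α → ℝ} (hfm : Measurable f) (hf0 : 0 ≤ f) (hf : IntegrableOn f s μ) :
    ∃ F ⊆ s, MeasurableSet F ∧ μ.real s / 2 ≤ μ.real F ∧ ∀ x ∈ F, f x ≤ 2 * ⨍ x in s, f x ∂μ := by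
  have : IsFiniteMeasure (μ.restrict s) := isFiniteMeasure_restrict.2 hs_top
  have hF : MeasurableSet {x | f x ≤ 2 * ⨍ x in s, f x ∂μ} :=
    measurableSet_le hfm measurable_const
  have hhalf := half_measureReal_le_measureReal_le_two_mul_average hf0 hf
  rw [measureReal_restrict_apply_univ, measureReal_restrict_apply hF] at hhalf
  exact ⟨_, Set.inter_subset_right, hF.inter hs, hhalf, fun x hx => hx.1⟩

theorem sq_integral_norm_le_of_support_subset [TopologicalSpace α] [OpensMeasurableSpace α]
    [IsFiniteMeasureOnCompacts μ] {E : Type*} [NormedAddCommGroup E] {K : Set α}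
    (hK : IsCompact K) (hKm : MeasurableSet K) {p : α → E} (hp : Continuous p)
    (hpK : Function.support p ⊆ K) :
    (∫ x, ‖p x‖ ∂μ) ^ 2 ≤ μ.real K * ∫ x, ‖p x‖ ^ 2 ∂μ := by
  have hp0 (x) (hx : x ∉ K) : ‖p x‖ = 0 := by
    rw [Function.notMem_support.1 fun h => hx (hpK h), norm_zero]
  rw [← setIntegral_eq_integral_of_forall_compl_eq_zero hp0,
    ← setIntegral_eq_integral_of_forall_compl_eq_zero (f := fun x => ‖p x‖ ^ 2) fun x hx => by
      rw [hp0 x hx, zero_pow two_ne_zero]]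
  exact sq_setIntegral_le hK.measure_ne_top (hp.norm.continuousOn.integrableOn_compact' hK hKm)
    ((hp.norm.pow 2).continuousOn.integrableOn_compact' hK hKm)

end Averages

section FourierInv

variable {V : Type*} [NormedAddCommGroup V] [InnerProductSpace ℝ V] [MeasurableSpace V]
  [BorelSpace V] [FiniteDimensional ℝ V] {E : Type*} [NormedAddCommGroup E] [NormedSpace ℂ E]
  {g : V → E}

theorem norm_fourierInv_le_integral_norm (g : V → E) (x : V) : ‖𝓕⁻ g x‖ ≤ ∫ ξ, ‖g ξ‖ :=
  VectorFourier.norm_fourierIntegral_le_integral_norm _ _ _ _ _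

theorem continuous_fourierInv (hg : Integrable g) : Continuous (𝓕⁻ g) :=
  VectorFourier.fourierIntegral_continuous Real.continuous_fourierChar
    (by simpa using! continuous_inner.neg) hg

theorem integrable_fourierChar_smul (hg : Integrable g) (x : V) :
    Integrable fun ξ => Real.fourierChar (inner ℝ ξ x) • g ξ := by
  simpa [inner_neg_right] using (Real.fourierIntegral_convergent_iff (f := g) (-x)).2 hg

theorem fourierInv_fourierChar_smul (g : V → E) (c x : V) :
    𝓕⁻ (fun ξ => Real.fourierChar (inner ℝ ξ c) • g ξ) x = 𝓕⁻ g (x + c) := by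
  simp only [Real.fourierInv_eq, inner_add_right, AddChar.map_add_eq_mul, smul_smul]

theorem fourierInv_smul_convolution_eq [CompleteSpace E] {χ : V → ℂ} (hχ : Integrable χ)
    (hg : Integrable g) (x : V) :
    𝓕⁻ (convolution χ g (ContinuousLinearMap.lsmul ℂ ℂ) volume) x = 𝓕⁻ χ x • 𝓕⁻ g x := by
  simp only [Real.fourierInv_eq_fourier_neg, Real.fourier_smul_convolution_eq hχ hg]

variable {H : Type*} [NormedAddCommGroup H] [InnerProductSpace ℂ H]
  [CompleteSpace H] {p : V → H}

theorem integral_norm_sq_fourierInv (hpc : Continuous p) (hp : Integrable p)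
    (hp' : Integrable (𝓕⁻ p)) : ∫ x, ‖𝓕⁻ p x‖ ^ 2 = ∫ ξ, ‖p ξ‖ ^ 2 := by
  have hp'' : Integrable (𝓕 p) := by
    simpa only [Real.fourierInv_eq_fourier_neg, neg_neg] using hp'.comp_neg
  have hsesq := VectorFourier.integral_sesq_fourierIntegral_eq_neg_flip (innerSL ℂ (E := H))
    (L := -innerₗ V) Real.continuous_fourierChar (by simpa using! continuous_inner.neg) hp hp'
  have hflip : -(-innerₗ V).flip = innerₗ V := by
    ext x y
    simp [real_inner_comm]
  rw [hflip] at hsesq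
  have hinv : 𝓕 (𝓕⁻ p) = p := hpc.fourier_fourierInv_eq hp hp''
  have h : ∫ x, inner ℂ (𝓕⁻ p x) (𝓕⁻ p x) = ∫ ξ, inner ℂ (p ξ) (𝓕 (𝓕⁻ p) ξ) := hsesq
  simp only [hinv, inner_self_eq_norm_sq_to_K] at h
  exact_mod_cast h

end FourierInv

section Extrapolation

variable {V : Type*} [NormedAddCommGroup V] [InnerProductSpace ℝ V] [FiniteDimensional ℝ V]
  [MeasurableSpace V] [BorelSpace V] {E : Type*} [NormedAddCommGroup E] [NormedSpace ℂ E]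
  {p : V → E}

theorem fourierInv_sub_sum_smul_eq (hp : Integrable p) (n : ℕ) (v c : ℕ → ℝ) (x y : V) :
    𝓕⁻ p x - ∑ j ∈ Finset.range (n + 1), (c j : ℂ) • 𝓕⁻ p (x + v j • y) =
      ∫ ξ, Real.fourierChar (inner ℝ ξ x) • (1 - ∑ j ∈ Finset.range (n + 1),
        (c j : ℂ) * Complex.exp ((2 * Real.pi * inner ℝ ξ y * v j : ℝ) * Complex.I)) • p ξ := by
  have hint (z : V) := integrable_fourierChar_smul hp z
  have hsum (j : ℕ) : Integrable fun ξ =>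
      (c j : ℂ) • Real.fourierChar (inner ℝ ξ (x + v j • y)) • p ξ := (hint _).smul (c j : ℂ)
  simp only [Real.fourierInv_eq, ← integral_smul]
  rw [← integral_finsetSum _ fun j _ => hsum j,
    ← integral_sub (hint x) (integrable_finsetSum _ fun j _ => hsum j)]
  refine integral_congr_ae (.of_forall fun ξ => ?_)
  simp only [Circle.smul_def, sub_smul, one_smul, smul_sub, Finset.sum_smul, Finset.smul_sum,
    smul_smul, inner_add_right, inner_smul_right, AddChar.map_add_eq_mul, Circle.coe_mul]
  congr 1
  refine Finset.sum_congr rfl fun j _ => ?_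
  rw [Real.fourierChar_apply (v j * inner ℝ ξ y),
    show 2 * Real.pi * (v j * inner ℝ ξ y) = 2 * Real.pi * inner ℝ ξ y * v j by ring]
  congr 1
  ring

theorem norm_fourierInv_le_sum_add (hp : Integrable p) {ρ : ℝ}
    (hpρ : Function.support p ⊆ Metric.closedBall 0 ρ) {n : ℕ} {v c : ℕ → ℝ}
    (hvc : ∀ a : ℝ, ‖1 - ∑ j ∈ Finset.range (n + 1),
      (c j : ℂ) * Complex.exp ((a * v j : ℝ) * Complex.I)‖ ≤ |a| ^ (n + 1) / (n + 1).factorial)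
    (x y : V) :
    ‖𝓕⁻ p x‖ ≤ ∑ j ∈ Finset.range (n + 1), |c j| * ‖𝓕⁻ p (x + v j • y)‖ +
      (2 * Real.pi * (ρ * ‖y‖)) ^ (n + 1) / (n + 1).factorial * ∫ ξ, ‖p ξ‖ := by
  have herror : ‖𝓕⁻ p x - ∑ j ∈ Finset.range (n + 1), (c j : ℂ) • 𝓕⁻ p (x + v j • y)‖ ≤
      (2 * Real.pi * (ρ * ‖y‖)) ^ (n + 1) / (n + 1).factorial * ∫ ξ, ‖p ξ‖ := by
    rw [fourierInv_sub_sum_smul_eq hp, ← integral_const_mul]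
    refine norm_integral_le_of_norm_le (hp.norm.const_mul _) (.of_forall fun ξ => ?_)
    rw [Circle.norm_smul, norm_smul]
    by_cases hξ : p ξ = 0
    · simp [hξ]
    have hξρ : ‖ξ‖ ≤ ρ := mem_closedBall_zero_iff.1 (hpρ hξ)
    have hphase : |2 * Real.pi * inner ℝ ξ y| ≤ 2 * Real.pi * (ρ * ‖y‖) := by
      rw [abs_mul, abs_of_pos Real.two_pi_pos]
      gcongr
      exact (abs_real_inner_le_norm ξ y).trans (by gcongr)
    refine mul_le_mul_of_nonneg_right ((hvc _).trans ?_) (norm_nonneg _)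
    gcongr
  have hsum : ‖∑ j ∈ Finset.range (n + 1), (c j : ℂ) • 𝓕⁻ p (x + v j • y)‖ ≤
      ∑ j ∈ Finset.range (n + 1), |c j| * ‖𝓕⁻ p (x + v j • y)‖ := by
    refine (norm_sum_le _ _).trans_eq (Finset.sum_congr rfl fun j _ => ?_)
    rw [norm_smul, Complex.norm_real, Real.norm_eq_abs]
  linarith [norm_sub_norm_le (𝓕⁻ p x)
    (∑ j ∈ Finset.range (n + 1), (c j : ℂ) • 𝓕⁻ p (x + v j • y))]

end Extrapolation

section LineNodes

variable {V : Type*} [NormedAddCommGroup V] [NormedSpace ℝ V] [FiniteDimensional ℝ V]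
  [MeasurableSpace V] [BorelSpace V] (μ : Measure V) {x : V} {ϱ m : ℝ}

/-- Bound for the total weight of the `n + 1` nodes used to extrapolate to the centre of a ball of
radius `ϱ` from a subset of measure at least `m`. -/
noncomputable def weightBound (n : ℕ) (ϱ m : ℝ) : ℝ :=
  Real.exp 1 * (8 * Real.exp 1 * μ.real (Metric.closedBall (0 : V) (2 * ϱ)) / m) ^ n

theorem exists_line_nodes_weights [μ.IsAddHaarMeasure] (n : ℕ) {F : Set V} (hF : MeasurableSet F)
    (hFx : F ⊆ Metric.closedBall x ϱ) (hm : 0 < m) (hFm : m ≤ μ.real F) :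
    ∃ y ∈ Metric.closedBall (0 : V) (2 * ϱ), ∃ v c : ℕ → ℝ, (∀ i ≤ n, x + v i • y ∈ F) ∧
      (∑ j ∈ Finset.range (n + 1), |c j| ≤ weightBound μ n ϱ m) ∧
      ∀ a : ℝ, ‖1 - ∑ j ∈ Finset.range (n + 1),
        (c j : ℂ) * Complex.exp ((a * v j : ℝ) * Complex.I)‖ ≤
          |a| ^ (n + 1) / (n + 1).factorial := by
  have hF_pos : 0 < μ.real F := hm.trans_le hFm
  have hF0 : μ F ≠ 0 := fun h => hF_pos.ne' (by rw [measureReal_def, h, ENNReal.toReal_zero])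
  obtain ⟨y, hy, hline⟩ := exists_measure_div_le_volume_line μ hF hFx hF0
  set b := μ.real (Metric.closedBall (0 : V) (2 * ϱ)) with hb_def
  set T := (fun t : ℝ => x + t • y) ⁻¹' F ∩ Set.Icc (1 / 2) 1
  have hB_top : μ (Metric.closedBall (0 : V) (2 * ϱ)) ≠ ⊤ := measure_closedBall_lt_top.ne
  have hϱ : 0 ≤ ϱ := Metric.nonempty_closedBall.1 ((nonempty_of_measure_ne_zero hF0).mono hFx)
  have hb : 0 < b := by
    refine hF_pos.trans_le ((measureReal_mono hFx measure_closedBall_lt_top.ne).trans ?_)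
    rw [Measure.addHaar_real_closedBall_center]
    exact measureReal_mono (Metric.closedBall_subset_closedBall (by linarith)) hB_top
  have hT : ENNReal.ofReal (m / (2 * b)) ≤ volume T := by
    refine le_trans ?_ hline
    rw [ENNReal.ofReal_div_of_pos (by positivity), ENNReal.ofReal_mul zero_le_two,
      ENNReal.ofReal_ofNat, ofReal_measureReal hB_top]
    gcongr
    exact ENNReal.ofReal_le_of_le_toReal hFm
  have hT1 : T ⊆ Set.Icc (-1) 1 :=
    Set.inter_subset_right.trans (Set.Icc_subset_Icc (by norm_num) le_rfl)
  obtain ⟨v, c, hvT, hc, hvc⟩ := exists_nodes_weights n hT1 (by positivity) hT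
  refine ⟨y, hy, v, c, fun i hi => (hvT i hi).1, hc.trans_eq ?_, hvc⟩
  rw [weightBound, ← hb_def]
  congr 2
  field_simp
  norm_num

end LineNodes

section PointwiseBound

variable {V : Type*} [NormedAddCommGroup V] [InnerProductSpace ℝ V] [FiniteDimensional ℝ V]
  [MeasurableSpace V] [BorelSpace V] {x : V} {ϱ ρ m : ℝ}

/-- Relative error of extrapolation with `n + 1` nodes to the centre of a ball of radius `ϱ`, for
functions whose frequencies have norm at most `ρ`. -/
noncomputable def extrapolationError (n : ℕ) (ϱ ρ : ℝ) : ℝ :=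
  (4 * Real.pi * ϱ * ρ) ^ (n + 1) / (n + 1).factorial

theorem norm_fourierInv_le_of_le_measureReal {E : Type*} [NormedAddCommGroup E] [NormedSpace ℂ E]
    {p : V → E} (hp : Integrable p) (hρ : 0 ≤ ρ)
    (hpρ : Function.support p ⊆ Metric.closedBall 0 ρ) (n : ℕ) {F : Set V}
    (hF : MeasurableSet F) (hFx : F ⊆ Metric.closedBall x ϱ) (hm : 0 < m)
    (hFm : m ≤ volume.real F) {M : ℝ} (hM : ∀ z ∈ F, ‖𝓕⁻ p z‖ ≤ M) :
    ‖𝓕⁻ p x‖ ≤ weightBound (volume : Measure V) n ϱ m * M +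
      extrapolationError n ϱ ρ * ∫ ξ, ‖p ξ‖ := by
  obtain ⟨y, hy, v, c, hvF, hc, hvc⟩ := exists_line_nodes_weights volume n hF hFx hm hFm
  have hM0 : 0 ≤ M := (norm_nonneg _).trans (hM _ (hvF 0 n.zero_le))
  refine (norm_fourierInv_le_sum_add hp hpρ hvc x y).trans (add_le_add ?_ ?_)
  · calc ∑ j ∈ Finset.range (n + 1), |c j| * ‖𝓕⁻ p (x + v j • y)‖
        ≤ ∑ j ∈ Finset.range (n + 1), |c j| * M := Finset.sum_le_sum fun j hj =>
          mul_le_mul_of_nonneg_left (hM _ (hvF j (Nat.lt_succ_iff.1 (Finset.mem_range.1 hj))))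
            (abs_nonneg _)
      _ ≤ _ := by
        rw [← Finset.sum_mul]
        gcongr
  · have hphase : 2 * Real.pi * (ρ * ‖y‖) ≤ 4 * Real.pi * ϱ * ρ := by
      have := mul_le_mul_of_nonneg_left (mem_closedBall_zero_iff.1 hy)
        (by positivity : 0 ≤ 2 * Real.pi * ρ)
      linarith
    rw [extrapolationError]
    gcongr

theorem norm_sq_fourierInv_le_of_le_measureReal {H : Type*} [NormedAddCommGroup H]
    [InnerProductSpace ℂ H] [CompleteSpace H] {p : V → H} (hpc : Continuous p) (hρ : 0 ≤ ρ)
    (hpρ : Function.support p ⊆ Metric.closedBall 0 ρ) (hp' : Integrable (𝓕⁻ p)) (n : ℕ)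
    {S : Set V} (hS : MeasurableSet S) (hSx : S ⊆ Metric.closedBall x ϱ) (hm : 0 < m)
    (hSm : m ≤ volume.real S) :
    ‖𝓕⁻ p x‖ ^ 2 ≤
      4 / m * weightBound (volume : Measure V) n ϱ (m / 2) ^ 2 * (∫ z in S, ‖𝓕⁻ p z‖ ^ 2) +
      2 * extrapolationError n ϱ ρ ^ 2 * volume.real (Metric.closedBall (0 : V) ρ) *
        ∫ z, ‖𝓕⁻ p z‖ ^ 2 := by
  have hp : Integrable p := hpc.integrable_of_hasCompactSupport
    (.of_support_subset_isCompact (isCompact_closedBall 0 ρ) hpρ)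
  have hcont : Continuous fun z => ‖𝓕⁻ p z‖ ^ 2 := (continuous_fourierInv hp).norm.pow 2
  have hfin : volume S ≠ ⊤ := measure_ne_top_of_subset hSx measure_closedBall_lt_top.ne
  have hint : IntegrableOn (fun z => ‖𝓕⁻ p z‖ ^ 2) S :=
    (hcont.continuousOn.integrableOn_compact (isCompact_closedBall x ϱ)).mono_set hSx
  set I := ∫ z in S, ‖𝓕⁻ p z‖ ^ 2 with hI
  have : 0 ≤ I := setIntegral_nonneg hS fun z _ => sq_nonneg _
  obtain ⟨F, hFS, hF, hFm, hM⟩ :=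
    exists_subset_forall_le_two_mul_setAverage hS hfin hcont.measurable (fun z => sq_nonneg _) hint
  have hM' (z) (hz : z ∈ F) : ‖𝓕⁻ p z‖ ≤ √(2 * (I / m)) := by
    refine Real.le_sqrt_of_sq_le ((hM z hz).trans ?_)
    rw [setAverage_eq, smul_eq_mul, ← hI, inv_mul_eq_div]
    gcongr
  have hpoint := norm_fourierInv_le_of_le_measureReal hp hρ hpρ n hF (hFS.trans hSx) (half_pos hm)
    (le_trans (by gcongr) hFm) hM'
  have hL2 := sq_integral_norm_le_of_support_subset (μ := volume) (isCompact_closedBall (0 : V) ρ)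
    measurableSet_closedBall hpc hpρ
  rw [← integral_norm_sq_fourierInv hpc hp hp'] at hL2
  set A := weightBound (volume : Measure V) n ϱ (m / 2)
  set R := extrapolationError n ϱ ρ
  calc ‖𝓕⁻ p x‖ ^ 2 ≤ (A * √(2 * (I / m)) + R * ∫ ξ, ‖p ξ‖) ^ 2 := by gcongr
    _ ≤ 2 * ((A * √(2 * (I / m))) ^ 2 + (R * ∫ ξ, ‖p ξ‖) ^ 2) := add_sq_le
    _ = 4 / m * A ^ 2 * I + 2 * R ^ 2 * (∫ ξ, ‖p ξ‖) ^ 2 := by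
        rw [mul_pow, mul_pow, Real.sq_sqrt (by positivity)]
        ring
    _ ≤ _ := by
        rw [mul_assoc (2 * R ^ 2)]
        exact add_le_add_right (mul_le_mul_of_nonneg_left hL2 (by positivity)) _

end PointwiseBound

section Window

variable {V : Type*} [NormedAddCommGroup V] [InnerProductSpace ℝ V] [FiniteDimensional ℝ V]
  [MeasurableSpace V] [BorelSpace V]

/-- A complex-valued smooth probability density supported in the ball of radius `φ.rOut`: the
Fourier-side profile of the band-limited weight `𝓕⁻ (window φ)` that localises functions. -/
noncomputable def window (φ : ContDiffBump (0 : V)) (ξ : V) : ℂ :=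
  (φ.normed volume ξ : ℝ)

variable (φ : ContDiffBump (0 : V))

theorem continuous_window : Continuous (window φ) :=
  Complex.continuous_ofReal.comp φ.continuous_normed

theorem hasCompactSupport_window : HasCompactSupport (window φ) :=
  φ.hasCompactSupport_normed.comp_left Complex.ofReal_zero

theorem integrable_window : Integrable (window φ) :=
  φ.integrable_normed.ofReal

theorem support_window_subset : Function.support (window φ) ⊆ Metric.closedBall 0 φ.rOut := by
  intro ξ hξ
  have hξ' : ξ ∈ Function.support (φ.normed volume) := by simpa [window] using hξ
  rw [φ.support_normed_eq] at hξ'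
  exact Metric.ball_subset_closedBall hξ'

theorem norm_window (ξ : V) : ‖window φ ξ‖ = φ.normed volume ξ := by
  rw [window, Complex.norm_real, Real.norm_of_nonneg (φ.nonneg_normed ξ)]

theorem integrable_fourierInv_window : Integrable (𝓕⁻ (window φ)) := by
  have h := (𝓕⁻ ((hasCompactSupport_window φ).toSchwartzMap
    (Complex.ofRealCLM.contDiff.comp φ.contDiff_normed))).integrable (μ := volume)
  rwa [SchwartzMap.fourierInv_coe] at h

theorem norm_fourierInv_window_le_one (x : V) : ‖𝓕⁻ (window φ) x‖ ≤ 1 := by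
  refine (norm_fourierInv_le_integral_norm _ x).trans_eq ?_
  simp only [norm_window, φ.integral_normed]

theorem half_le_norm_fourierInv_window {x : V} (hx : 2 * Real.pi * ‖x‖ * φ.rOut ≤ 1) :
    1 / 2 ≤ ‖𝓕⁻ (window φ) x‖ := by
  have hcos (ξ : V) : 1 / 2 * φ.normed volume ξ ≤
      (Real.fourierChar (inner ℝ ξ x) • window φ ξ).re := by
    by_cases hξ : window φ ξ = 0
    · rw [← norm_window, hξ, norm_zero, smul_zero, mul_zero, Complex.zero_re]
    have hphase : |2 * Real.pi * inner ℝ ξ x| ≤ 1 := by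
      rw [abs_mul, abs_of_pos Real.two_pi_pos]
      have hξ' : ‖ξ‖ ≤ φ.rOut := mem_closedBall_zero_iff.1 (support_window_subset φ hξ)
      calc 2 * Real.pi * |inner ℝ ξ x| ≤ 2 * Real.pi * (φ.rOut * ‖x‖) := by
            gcongr
            exact (abs_real_inner_le_norm ξ x).trans (by gcongr)
        _ ≤ 1 := by linarith
    have hsq : (2 * Real.pi * inner ℝ ξ x) ^ 2 ≤ 1 := (sq_le_one_iff_abs_le_one _).2 hphase
    have hre : (Real.fourierChar (inner ℝ ξ x) • window φ ξ).re =
        Real.cos (2 * Real.pi * inner ℝ ξ x) * φ.normed volume ξ := by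
      rw [Circle.smul_def, smul_eq_mul, window, Complex.re_mul_ofReal, Real.fourierChar_apply,
        Complex.exp_ofReal_mul_I_re]
    rw [hre]
    refine mul_le_mul_of_nonneg_right ?_ (φ.nonneg_normed ξ)
    linarith [Real.one_sub_sq_div_two_le_cos (x := 2 * Real.pi * inner ℝ ξ x)]
  have hint := integrable_fourierChar_smul (integrable_window φ) x
  calc 1 / 2 = ∫ ξ, 1 / 2 * φ.normed volume ξ := by
        rw [integral_const_mul, φ.integral_normed, mul_one]
    _ ≤ ∫ ξ, (Real.fourierChar (inner ℝ ξ x) • window φ ξ).re :=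
        integral_mono (φ.integrable_normed.const_mul _) hint.re hcos
    _ = (𝓕⁻ (window φ) x).re := by rw [Real.fourierInv_eq]; exact integral_re hint
    _ ≤ ‖𝓕⁻ (window φ) x‖ := Complex.re_le_norm _

theorem integral_norm_sq_fourierInv_window_le :
    ∫ x, ‖𝓕⁻ (window φ) x‖ ^ 2 ≤ 1 / volume.real (Metric.closedBall (0 : V) φ.rIn) := by
  rw [integral_norm_sq_fourierInv (continuous_window φ) (integrable_window φ)
    (integrable_fourierInv_window φ)]
  set b := 1 / volume.real (Metric.closedBall (0 : V) φ.rIn)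
  have hle (ξ : V) : ‖window φ ξ‖ ^ 2 ≤ b * φ.normed volume ξ := by
    rw [norm_window, sq]
    exact mul_le_mul_of_nonneg_right (φ.normed_le_div_measure_closedBall_rIn volume ξ)
      (φ.nonneg_normed ξ)
  refine (integral_mono_of_nonneg (.of_forall fun ξ => sq_nonneg _)
    (φ.integrable_normed.const_mul b) (.of_forall hle)).trans_eq ?_
  rw [integral_const_mul, φ.integral_normed, mul_one]

variable {E : Type*} [NormedAddCommGroup E] [NormedSpace ℂ E] {g : V → E}

theorem continuous_window_convolution (hg : Integrable g) :
    Continuous (convolution (window φ) g (ContinuousLinearMap.lsmul ℂ ℂ) volume) :=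
  (hasCompactSupport_window φ).continuous_convolution_left _ (continuous_window φ)
    hg.locallyIntegrable

theorem support_window_convolution_subset {r : ℝ}
    (hgr : Function.support g ⊆ Metric.closedBall 0 r) :
    Function.support (convolution (window φ) g (ContinuousLinearMap.lsmul ℂ ℂ) volume) ⊆
      Metric.closedBall 0 (r + φ.rOut) := by
  intro ξ hξ
  obtain ⟨ζ, hζ, η, hη, rfl⟩ := support_convolution_subset _ hξ
  refine mem_closedBall_zero_iff.2 ((norm_add_le ζ η).trans ?_)
  linarith [mem_closedBall_zero_iff.1 (support_window_subset φ hζ),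
    mem_closedBall_zero_iff.1 (hgr hη)]

theorem integrable_fourierInv_window_smul (hg : Integrable g) :
    Integrable fun x => 𝓕⁻ (window φ) x • 𝓕⁻ g x :=
  (integrable_fourierInv_window φ).smul_bdd (∫ ξ, ‖g ξ‖)
    (continuous_fourierInv hg).aestronglyMeasurable
    (.of_forall (norm_fourierInv_le_integral_norm g))

end Window

section Translates

variable {V : Type*} [AddGroup V] [MeasurableSpace V] [MeasurableAdd₂ V]

theorem lintegral_lintegral_add_right {μ ν : Measure V} [SFinite μ] [SFinite ν]
    [μ.IsAddLeftInvariant] {G : V → ENNReal} (hG : Measurable G) :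
    ∫⁻ c, ∫⁻ x, G (x + c) ∂ν ∂μ = ν Set.univ * ∫⁻ x, G x ∂μ := by
  rw [lintegral_lintegral_swap (by fun_prop)]
  simp only [lintegral_add_left_eq_self G, lintegral_const, mul_comm]

end Translates

section EnormSq

variable {α E : Type*} [MeasurableSpace α] {μ : Measure α} [NormedAddCommGroup E]

theorem ofReal_integral_norm_sq_le_lintegral (f : α → E) :
    ENNReal.ofReal (∫ x, ‖f x‖ ^ 2 ∂μ) ≤ ∫⁻ x, ‖f x‖ₑ ^ 2 ∂μ :=
  calc ENNReal.ofReal (∫ x, ‖f x‖ ^ 2 ∂μ) ≤ ‖∫ x, ‖f x‖ ^ 2 ∂μ‖ₑ := Real.ofReal_le_enorm _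
    _ ≤ ∫⁻ x, ‖‖f x‖ ^ 2‖ₑ ∂μ := enorm_integral_le_lintegral_enorm _
    _ = ∫⁻ x, ‖f x‖ₑ ^ 2 ∂μ := by simp only [enorm_pow, enorm_norm]

end EnormSq

section Coefficients

variable {V : Type*} [NormedAddCommGroup V] [MeasureSpace V] {n : ℕ} {ϱ m ρ : ℝ}

/-- Coefficient of the mass on an observed set of measure at least `m` inside a ball of radius `ϱ`,
in the bound for a band-limited function on that ball by extrapolation with `n + 1` nodes. -/
noncomputable def observationGain (V : Type*) [NormedAddCommGroup V] [MeasureSpace V] (n : ℕ)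
    (ϱ m : ℝ) : ℝ :=
  16 / m * weightBound (volume : Measure V) n (2 * ϱ) (m / 2) ^ 2

/-- Coefficient of the windowed total mass in that bound, for frequencies of norm at most `ρ`. -/
noncomputable def leakage (V : Type*) [NormedAddCommGroup V] [MeasureSpace V] (n : ℕ)
    (ϱ ρ : ℝ) : ℝ :=
  8 * extrapolationError n (2 * ϱ) ρ ^ 2 * volume.real (Metric.closedBall (0 : V) ρ)

theorem observationGain_nonneg (hm : 0 ≤ m) : 0 ≤ observationGain V n ϱ m := by
  rw [observationGain]
  positivity

theorem leakage_nonneg : 0 ≤ leakage V n ϱ ρ := by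
  rw [leakage]
  positivity

end Coefficients

section Local

variable {V : Type*} [NormedAddCommGroup V] [InnerProductSpace ℝ V] [FiniteDimensional ℝ V]
  [MeasurableSpace V] [BorelSpace V] {H : Type*} [NormedAddCommGroup H] [InnerProductSpace ℂ H]
  [CompleteSpace H] {g : V → H} {r ϱ m : ℝ} {φ : ContDiffBump (0 : V)} {Q S : Set V}

theorem norm_sq_fourierInv_le_add (hg : Integrable g) (hr : 0 ≤ r)
    (hgr : Function.support g ⊆ Metric.closedBall 0 r) (n : ℕ)
    (hQ : Q ⊆ Metric.closedBall 0 ϱ) (hφ : 2 * Real.pi * ϱ * φ.rOut ≤ 1)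
    (hS : MeasurableSet S) (hSQ : S ⊆ Q) (hm : 0 < m) (hSm : m ≤ volume.real S) {x : V}
    (hx : x ∈ Q) :
    ‖𝓕⁻ g x‖ ^ 2 ≤ observationGain V n ϱ m * (∫ z in S, ‖𝓕⁻ g z‖ ^ 2) +
      leakage V n ϱ (r + φ.rOut) * ∫ z, ‖𝓕⁻ (window φ) z • 𝓕⁻ g z‖ ^ 2 := by
  set p := convolution (window φ) g (ContinuousLinearMap.lsmul ℂ ℂ) volume
  have hp (z : V) : 𝓕⁻ p z = 𝓕⁻ (window φ) z • 𝓕⁻ g z :=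
    fourierInv_smul_convolution_eq (integrable_window φ) hg z
  have hpi : Integrable (𝓕⁻ p) := by
    rw [funext hp]
    exact integrable_fourierInv_window_smul φ hg
  have hSx : S ⊆ Metric.closedBall x (2 * ϱ) := fun z hz => by
    have hx0 := mem_closedBall_zero_iff.1 (hQ hx)
    have hz0 := mem_closedBall_zero_iff.1 (hQ (hSQ hz))
    rw [mem_closedBall_iff_norm]
    linarith [norm_sub_le z x]
  have hpc : Continuous p := continuous_window_convolution φ hg
  have hpρ : Function.support p ⊆ Metric.closedBall 0 (r + φ.rOut) :=
    support_window_convolution_subset φ hgr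
  have hpoint := norm_sq_fourierInv_le_of_le_measureReal hpc (add_nonneg hr φ.rOut_pos.le) hpρ hpi
    n hS hSx hm hSm
  have hwindow : 1 / 2 ≤ ‖𝓕⁻ (window φ) x‖ := half_le_norm_fourierInv_window φ <| by
    refine le_trans ?_ hφ
    have := φ.rOut_pos
    gcongr
    exact mem_closedBall_zero_iff.1 (hQ hx)
  have hlower : ‖𝓕⁻ g x‖ ^ 2 ≤ 4 * ‖𝓕⁻ p x‖ ^ 2 := by
    rw [hp, norm_smul]
    nlinarith [norm_nonneg (𝓕⁻ g x), mul_le_mul_of_nonneg_right hwindow (norm_nonneg (𝓕⁻ g x))]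
  have hupper : ∫ z in S, ‖𝓕⁻ p z‖ ^ 2 ≤ ∫ z in S, ‖𝓕⁻ g z‖ ^ 2 := by
    refine integral_mono_of_nonneg (.of_forall fun z => sq_nonneg _) ?_ (.of_forall fun z => ?_)
    · exact (((continuous_fourierInv hg).norm.pow 2).continuousOn.integrableOn_compact
        (isCompact_closedBall 0 ϱ)).mono_set (hSQ.trans hQ)
    · simp only [hp, norm_smul]
      gcongr
      exact mul_le_of_le_one_left (norm_nonneg _) (norm_fourierInv_window_le_one φ z)
  have hobs : observationGain V n ϱ m * (∫ z in S, ‖𝓕⁻ p z‖ ^ 2) ≤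
      observationGain V n ϱ m * ∫ z in S, ‖𝓕⁻ g z‖ ^ 2 :=
    mul_le_mul_of_nonneg_left hupper (observationGain_nonneg hm.le)
  simp only [← hp]
  rw [observationGain] at hobs ⊢
  rw [leakage]
  linear_combination hlower + 4 * hpoint + hobs

theorem setLIntegral_enorm_sq_fourierInv_le (hg : Integrable g) (hr : 0 ≤ r)
    (hgr : Function.support g ⊆ Metric.closedBall 0 r) (n : ℕ) (hQm : MeasurableSet Q)
    (hQ : Q ⊆ Metric.closedBall 0 ϱ) (hφ : 2 * Real.pi * ϱ * φ.rOut ≤ 1)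
    (hS : MeasurableSet S) (hSQ : S ⊆ Q) (hm : 0 < m) (hSm : m ≤ volume.real S) :
    ∫⁻ x in Q, ‖𝓕⁻ g x‖ₑ ^ 2 ≤ volume Q *
      (ENNReal.ofReal (observationGain V n ϱ m) * (∫⁻ z in S, ‖𝓕⁻ g z‖ₑ ^ 2) +
        ENNReal.ofReal (leakage V n ϱ (r + φ.rOut)) *
          ∫⁻ z, ‖𝓕⁻ (window φ) z‖ₑ ^ 2 * ‖𝓕⁻ g z‖ₑ ^ 2) := by
  rw [mul_comm, ← setLIntegral_const]
  refine setLIntegral_mono' hQm fun x hx => ?_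
  have h := norm_sq_fourierInv_le_add hg hr hgr n hQ hφ hS hSQ hm hSm hx
  simp only [← mul_pow, ← enorm_smul]
  calc ‖𝓕⁻ g x‖ₑ ^ 2 = ENNReal.ofReal (‖𝓕⁻ g x‖ ^ 2) := by
        rw [ENNReal.ofReal_pow (norm_nonneg _), ofReal_norm]
    _ ≤ _ := ENNReal.ofReal_le_ofReal h
    _ ≤ _ := ENNReal.ofReal_add_le
    _ ≤ _ := by
        rw [ENNReal.ofReal_mul (observationGain_nonneg hm.le), ENNReal.ofReal_mul leakage_nonneg]
        gcongr <;> exact ofReal_integral_norm_sq_le_lintegral _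

end Local

section Global

variable {V : Type*} [NormedAddCommGroup V] [InnerProductSpace ℝ V] [FiniteDimensional ℝ V]
  [MeasurableSpace V] [BorelSpace V] {H : Type*} [NormedAddCommGroup H] [InnerProductSpace ℂ H]
  [CompleteSpace H] {g : V → H} {r ϱ m : ℝ} {φ : ContDiffBump (0 : V)} {Q ω : Set V}

theorem setLIntegral_translate_enorm_sq_fourierInv_le (hg : Integrable g) (hr : 0 ≤ r)
    (hgr : Function.support g ⊆ Metric.closedBall 0 r) (n : ℕ) (hQm : MeasurableSet Q)
    (hQ : Q ⊆ Metric.closedBall 0 ϱ) (hφ : 2 * Real.pi * ϱ * φ.rOut ≤ 1) (hω : MeasurableSet ω)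
    (hm : 0 < m) {c : V} (hωc : m ≤ volume.real ((· + c) ⁻¹' ω ∩ Q)) :
    ∫⁻ x in Q, ‖𝓕⁻ g (x + c)‖ₑ ^ 2 ≤ volume Q *
      (ENNReal.ofReal (observationGain V n ϱ m) *
          (∫⁻ x in Q, ω.indicator (fun z => ‖𝓕⁻ g z‖ₑ ^ 2) (x + c)) +
        ENNReal.ofReal (leakage V n ϱ (r + φ.rOut)) *
          ∫⁻ x, ‖𝓕⁻ (window φ) x‖ₑ ^ 2 * ‖𝓕⁻ g (x + c)‖ₑ ^ 2) := by
  have hωc_meas : MeasurableSet ((· + c) ⁻¹' ω) := measurable_add_const c hω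
  have hsupp : Function.support (fun ξ => Real.fourierChar (inner ℝ ξ c) • g ξ) ⊆
      Metric.closedBall 0 r :=
    (Function.support_smul_subset_right _ _).trans hgr
  have h := setLIntegral_enorm_sq_fourierInv_le (integrable_fourierChar_smul hg c) hr hsupp n hQm
    hQ hφ (hωc_meas.inter hQm) Set.inter_subset_right hm hωc
  simp only [fourierInv_fourierChar_smul] at h
  rwa [← Measure.restrict_restrict hωc_meas, ← lintegral_indicator hωc_meas] at h

theorem lintegral_enorm_sq_fourierInv_le_add (hg : Integrable g) (hr : 0 ≤ r)
    (hgr : Function.support g ⊆ Metric.closedBall 0 r) (n : ℕ) (hQm : MeasurableSet Q)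
    (hQ : Q ⊆ Metric.closedBall 0 ϱ) (hQ0 : volume Q ≠ 0)
    (hφ : 2 * Real.pi * ϱ * φ.rOut ≤ 1) (hω : MeasurableSet ω)
    (hm : 0 < m) (hthick : ∀ c, m ≤ volume.real ((· + c) ⁻¹' ω ∩ Q)) :
    ∫⁻ x, ‖𝓕⁻ g x‖ₑ ^ 2 ≤
      ENNReal.ofReal (observationGain V n ϱ m) * (volume Q * ∫⁻ x in ω, ‖𝓕⁻ g x‖ₑ ^ 2) +
        ENNReal.ofReal (leakage V n ϱ (r + φ.rOut)) *
          ((∫⁻ x, ‖𝓕⁻ (window φ) x‖ₑ ^ 2) * ∫⁻ x, ‖𝓕⁻ g x‖ₑ ^ 2) := by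
  have hQ_top : volume Q ≠ ⊤ := measure_ne_top_of_subset hQ measure_closedBall_lt_top.ne
  have hF : Measurable fun x => ‖𝓕⁻ g x‖ₑ ^ 2 :=
    (continuous_fourierInv hg).enorm.measurable.pow_const 2
  have hW : Measurable fun x => ‖𝓕⁻ (window φ) x‖ₑ ^ 2 :=
    (continuous_fourierInv (integrable_window φ)).measurable.enorm.pow_const 2
  set F := fun x => ‖𝓕⁻ g x‖ₑ ^ 2
  have hQ_avg {G : V → ENNReal} (hG : Measurable G) :
      ∫⁻ c, ∫⁻ x in Q, G (x + c) = volume Q * ∫⁻ x, G x := by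
    rw [lintegral_lintegral_add_right hG, Measure.restrict_apply_univ]
  have hW_avg : ∫⁻ c, ∫⁻ x, ‖𝓕⁻ (window φ) x‖ₑ ^ 2 * F (x + c) =
      (∫⁻ x, ‖𝓕⁻ (window φ) x‖ₑ ^ 2) * ∫⁻ x, F x := by
    have h := lintegral_lintegral_add_right (μ := volume)
      (ν := volume.withDensity fun x => ‖𝓕⁻ (window φ) x‖ₑ ^ 2) hF
    rw [withDensity_apply _ .univ, setLIntegral_univ] at h
    rw [← h]
    exact lintegral_congr fun c =>
      (lintegral_withDensity_eq_lintegral_mul _ hW (by fun_prop)).symm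
  refine (ENNReal.mul_le_mul_iff_right hQ0 hQ_top).1 ?_
  calc volume Q * ∫⁻ x, F x = ∫⁻ c, ∫⁻ x in Q, F (x + c) := (hQ_avg hF).symm
    _ ≤ ∫⁻ c, volume Q * (ENNReal.ofReal (observationGain V n ϱ m) *
            (∫⁻ x in Q, ω.indicator F (x + c)) +
          ENNReal.ofReal (leakage V n ϱ (r + φ.rOut)) *
            ∫⁻ x, ‖𝓕⁻ (window φ) x‖ₑ ^ 2 * F (x + c)) :=
        lintegral_mono fun c => setLIntegral_translate_enorm_sq_fourierInv_le hg hr hgr n hQm hQ hφ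
          hω hm (hthick c)
    _ = _ := by
        have hmeas : Measurable fun c => ∫⁻ x in Q, ω.indicator F (x + c) :=
          ((hF.indicator hω).comp measurable_add).lintegral_prod_left'
        rw [lintegral_const_mul' _ _ hQ_top, lintegral_add_left (hmeas.const_mul _),
          lintegral_const_mul' _ _ ENNReal.ofReal_ne_top,
          lintegral_const_mul' _ _ ENNReal.ofReal_ne_top, hQ_avg (hF.indicator hω), hW_avg,
          lintegral_indicator hω]

theorem lintegral_enorm_sq_fourierInv_window_le (φ : ContDiffBump (0 : V)) :
    ∫⁻ x, ‖𝓕⁻ (window φ) x‖ₑ ^ 2 ≤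
      ENNReal.ofReal (1 / volume.real (Metric.closedBall (0 : V) φ.rIn)) := by
  have hint : Integrable fun x => ‖𝓕⁻ (window φ) x‖ ^ 2 := by
    simp only [sq]
    exact (integrable_fourierInv_window φ).norm.mul_bdd (c := 1)
      (continuous_fourierInv (integrable_window φ)).norm.aestronglyMeasurable
      (.of_forall fun x => by simpa using norm_fourierInv_window_le_one φ x)
  calc ∫⁻ x, ‖𝓕⁻ (window φ) x‖ₑ ^ 2 = ∫⁻ x, ENNReal.ofReal (‖𝓕⁻ (window φ) x‖ ^ 2) := by
        simp only [ENNReal.ofReal_pow (norm_nonneg _), ofReal_norm]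
    _ = ENNReal.ofReal (∫ x, ‖𝓕⁻ (window φ) x‖ ^ 2) :=
        (ofReal_integral_eq_lintegral_ofReal hint (.of_forall fun x => sq_nonneg _)).symm
    _ ≤ _ := ENNReal.ofReal_le_ofReal (integral_norm_sq_fourierInv_window_le φ)

theorem lintegral_enorm_sq_fourierInv_le (hg : Integrable g) (hr : 0 ≤ r)
    (hgr : Function.support g ⊆ Metric.closedBall 0 r)
    (hfin : ∫⁻ x, ‖𝓕⁻ g x‖ₑ ^ 2 ≠ ⊤) {n : ℕ} (hQm : MeasurableSet Q)
    (hQ : Q ⊆ Metric.closedBall 0 ϱ) (hQ0 : volume Q ≠ 0) (hφ : 2 * Real.pi * ϱ * φ.rOut ≤ 1)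
    (hleak : 2 * leakage V n ϱ (r + φ.rOut) ≤ volume.real (Metric.closedBall (0 : V) φ.rIn))
    (hω : MeasurableSet ω) (hm : 0 < m) (hthick : ∀ c, m ≤ volume.real ((· + c) ⁻¹' ω ∩ Q)) :
    ∫⁻ x, ‖𝓕⁻ g x‖ₑ ^ 2 ≤
      2 * ENNReal.ofReal (observationGain V n ϱ m) * volume Q * ∫⁻ x in ω, ‖𝓕⁻ g x‖ₑ ^ 2 := by
  have h := lintegral_enorm_sq_fourierInv_le_add hg hr hgr n hQm hQ hQ0 hφ hω hm hthick
  have hball : 0 < volume.real (Metric.closedBall (0 : V) φ.rIn) :=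
    ENNReal.toReal_pos (Metric.measure_closedBall_pos volume 0 φ.rIn_pos).ne'
      measure_closedBall_lt_top.ne
  have habsorb : ENNReal.ofReal (leakage V n ϱ (r + φ.rOut)) *
      (∫⁻ x, ‖𝓕⁻ (window φ) x‖ₑ ^ 2) ≤ 2⁻¹ := by
    calc _ ≤ ENNReal.ofReal (leakage V n ϱ (r + φ.rOut)) *
          ENNReal.ofReal (1 / volume.real (Metric.closedBall (0 : V) φ.rIn)) :=
          mul_le_mul_right (lintegral_enorm_sq_fourierInv_window_le φ) _
      _ = ENNReal.ofReal (leakage V n ϱ (r + φ.rOut) /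
            volume.real (Metric.closedBall (0 : V) φ.rIn)) := by
          rw [← ENNReal.ofReal_mul leakage_nonneg, mul_one_div]
      _ ≤ ENNReal.ofReal 2⁻¹ := by
          refine ENNReal.ofReal_le_ofReal ((div_le_iff₀ hball).2 ?_)
          linarith
      _ = 2⁻¹ := by rw [ENNReal.ofReal_inv_of_pos two_pos, ENNReal.ofReal_ofNat]
  set M := ∫⁻ x, ‖𝓕⁻ g x‖ₑ ^ 2
  set O := ∫⁻ x in ω, ‖𝓕⁻ g x‖ₑ ^ 2
  set α := ENNReal.ofReal (observationGain V n ϱ m)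
  have hhalf : M / 2 + M / 2 ≤ α * (volume Q * O) + M / 2 := by
    rw [ENNReal.add_halves]
    refine h.trans (add_le_add_right ?_ _)
    rw [← mul_assoc, ENNReal.div_eq_inv_mul]
    gcongr
  calc M = 2 * (M / 2) := (ENNReal.mul_div_cancel two_ne_zero ENNReal.ofNat_ne_top).symm
    _ ≤ 2 * (α * (volume Q * O)) :=
        mul_le_mul_right ((ENNReal.add_le_add_iff_right (by finiteness)).1 hhalf) _
    _ = 2 * α * volume Q * O := by ring

end Global

section Numerics

theorem pow_div_factorial_le_exp_sub {x : ℝ} (hx : 0 ≤ x) (k : ℕ) :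
    x ^ k / k.factorial ≤ Real.exp (Real.exp 1 * x - k) := by
  have h := Real.pow_div_factorial_le_exp (Real.exp 1 * x) (by positivity) k
  rw [mul_pow, Real.exp_one_pow, mul_div_assoc] at h
  rwa [Real.exp_sub, le_div_iff₀' (Real.exp_pos _)]

theorem sixteen_mul_pow_mul_sq_pow_div_factorial_le_one {κ : ℝ} (hκ : 1 ≤ κ) {d n : ℕ}
    (hn : (d + 12) * κ ≤ n) :
    16 * (2 * κ) ^ d * ((4 * κ) ^ (n + 1) / (n + 1).factorial) ^ 2 ≤ 1 := by
  have he : Real.exp 1 ≤ 2.75 := Real.exp_one_lt_d9.le.trans (by norm_num)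
  have h16 : 16 ≤ Real.exp 3 := by
    calc (16 : ℝ) ≤ 2.7 ^ 3 := by norm_num
      _ ≤ Real.exp 1 ^ 3 := by
        gcongr
        exact le_trans (by norm_num) Real.exp_one_gt_d9.le
      _ = Real.exp 3 := by rw [Real.exp_one_pow, Nat.cast_ofNat]
  have hpow : (2 * κ) ^ d ≤ Real.exp (d * (2 * κ)) := by
    rw [Real.exp_nat_mul]
    gcongr
    linarith [Real.add_one_le_exp (2 * κ)]
  calc 16 * (2 * κ) ^ d * ((4 * κ) ^ (n + 1) / (n + 1).factorial) ^ 2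
      ≤ Real.exp 3 * Real.exp (d * (2 * κ)) *
          Real.exp (Real.exp 1 * (4 * κ) - (n + 1 : ℕ)) ^ 2 := by
        gcongr
        exact pow_div_factorial_le_exp_sub (by positivity) (n + 1)
    _ = Real.exp (3 + d * (2 * κ) + 2 * (Real.exp 1 * (4 * κ) - (n + 1 : ℕ))) := by
        rw [Real.exp_add, Real.exp_add, two_mul (_ - _), Real.exp_add, sq]
    _ ≤ 1 := by
        rw [Real.exp_le_one_iff]
        push_cast
        nlinarith

theorem mul_sq_exp_one_mul_pow_le_sq_rpow {C D γ t : ℝ} {n : ℕ} (hγ : 0 < γ) (hγ1 : γ ≤ 1)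
    (hD : 0 ≤ D) (hCD : D ≤ C) (hC : 32 * Real.exp 1 ^ 2 ≤ C) (hn : n + 1 ≤ C * t) :
    32 / γ * (Real.exp 1 * (D / γ) ^ n) ^ 2 ≤ ((C / γ) ^ (C * t)) ^ 2 := by
  have hX : 1 ≤ C / γ := by
    rw [le_div_iff₀ hγ]
    nlinarith [Real.add_one_le_exp 1]
  calc 32 / γ * (Real.exp 1 * (D / γ) ^ n) ^ 2
      = 32 * Real.exp 1 ^ 2 / γ * ((D / γ) ^ n) ^ 2 := by ring
    _ ≤ C / γ * ((C / γ) ^ n) ^ 2 := by gcongr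
    _ ≤ (C / γ) ^ 2 * ((C / γ) ^ n) ^ 2 := by
        gcongr
        exact le_self_pow₀ hX two_ne_zero
    _ = ((C / γ) ^ ((n + 1 : ℕ) : ℝ)) ^ 2 := by
        rw [Real.rpow_natCast]
        ring
    _ ≤ ((C / γ) ^ (C * t)) ^ 2 := by
        gcongr
        exact_mod_cast hn

end Numerics

section Scales

variable {V : Type*} [NormedAddCommGroup V] [InnerProductSpace ℝ V] [FiniteDimensional ℝ V]
  [MeasurableSpace V] [BorelSpace V] {r ϱ γ : ℝ} {n : ℕ}

theorem two_mul_leakage_le (hϱ : 0 < ϱ) (hr : 0 ≤ r)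
    (hn : (Module.finrank ℝ V + 12) * (2 * Real.pi * ϱ * r + 1) ≤ n) :
    2 * leakage V n ϱ (r + 1 / (2 * Real.pi * ϱ)) ≤
      volume.real (Metric.closedBall (0 : V) (1 / (2 * Real.pi * ϱ) / 2)) := by
  set κ := 2 * Real.pi * ϱ * r + 1 with hκ_def
  set σ := 1 / (2 * Real.pi * ϱ) with hσ_def
  have hκ : 1 ≤ κ := le_add_of_nonneg_left (by positivity)
  have : 0 < σ := by positivity
  have hκσ : r + σ = κ * σ := by
    rw [hκ_def, hσ_def]
    field_simp
  have hfreq : 4 * Real.pi * (2 * ϱ) * (κ * σ) = 4 * κ := by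
    rw [hσ_def]
    field_simp
  have h := sixteen_mul_pow_mul_sq_pow_div_factorial_le_one hκ hn
  set R := (4 * κ) ^ (n + 1) / (n + 1).factorial
  rw [leakage, extrapolationError, hκσ, hfreq, Measure.addHaar_real_closedBall _ _ (by positivity),
    Measure.addHaar_real_closedBall _ _ (by positivity)]
  set b := volume.real (Metric.ball (0 : V) 1)
  calc 2 * (8 * R ^ 2 * ((κ * σ) ^ Module.finrank ℝ V * b))
      = 16 * (2 * κ) ^ Module.finrank ℝ V * R ^ 2 * ((σ / 2) ^ Module.finrank ℝ V * b) := by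
        rw [show κ * σ = 2 * κ * (σ / 2) by ring, mul_pow (2 * κ)]
        ring
    _ ≤ (σ / 2) ^ Module.finrank ℝ V * b := mul_le_of_le_one_left (by positivity) h

theorem two_mul_ofReal_observationGain_mul {Q : Set V} (hQ0 : volume Q ≠ 0) (hQ_top : volume Q ≠ ⊤)
    (hγ : 0 < γ) :
    2 * ENNReal.ofReal (observationGain V n ϱ (γ * volume.real Q)) * volume Q =
      ENNReal.ofReal (32 / γ * (Real.exp 1 * (16 * Real.exp 1 *
        volume.real (Metric.closedBall (0 : V) (4 * ϱ)) / volume.real Q / γ) ^ n) ^ 2) := by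
  have hQ : 0 < volume.real Q := ENNReal.toReal_pos hQ0 hQ_top
  rw [← ENNReal.ofReal_ofNat, ← ofReal_measureReal hQ_top, ← ENNReal.ofReal_mul zero_le_two,
    ← ENNReal.ofReal_mul (mul_nonneg zero_le_two (observationGain_nonneg (by positivity))),
    observationGain, weightBound]
  congr 1
  rw [show 2 * (2 * ϱ) = 4 * ϱ by ring]
  have hbase : 8 * Real.exp 1 * volume.real (Metric.closedBall (0 : V) (4 * ϱ)) /
      (γ * volume.real Q / 2) =
      16 * Real.exp 1 * volume.real (Metric.closedBall (0 : V) (4 * ϱ)) / volume.real Q / γ := by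
    field_simp
    ring
  rw [hbase]
  field_simp
  ring

theorem lintegral_enorm_sq_fourierInv_le_of_forall_le_measureReal {H : Type*} [NormedAddCommGroup H]
    [InnerProductSpace ℂ H] [CompleteSpace H] {g : V → H} (hg : Integrable g) (hr : 0 ≤ r)
    (hgr : Function.support g ⊆ Metric.closedBall 0 r)
    (hfin : ∫⁻ x, ‖𝓕⁻ g x‖ₑ ^ 2 ≠ ⊤) {Q ω : Set V} (hQm : MeasurableSet Q) (hϱ : 0 < ϱ)
    (hQ : Q ⊆ Metric.closedBall 0 ϱ) (hQ0 : volume Q ≠ 0) (hω : MeasurableSet ω) (hγ : 0 < γ)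
    (hthick : ∀ c, γ * volume.real Q ≤ volume.real ((· + c) ⁻¹' ω ∩ Q))
    (hn : (Module.finrank ℝ V + 12) * (2 * Real.pi * ϱ * r + 1) ≤ n) :
    ∫⁻ x, ‖𝓕⁻ g x‖ₑ ^ 2 ≤
      ENNReal.ofReal (32 / γ * (Real.exp 1 * (16 * Real.exp 1 *
        volume.real (Metric.closedBall (0 : V) (4 * ϱ)) / volume.real Q / γ) ^ n) ^ 2) *
        ∫⁻ x in ω, ‖𝓕⁻ g x‖ₑ ^ 2 := by
  have hQ_top : volume Q ≠ ⊤ := measure_ne_top_of_subset hQ measure_closedBall_lt_top.ne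
  have hσ : 0 < 1 / (2 * Real.pi * ϱ) := by positivity
  let φ : ContDiffBump (0 : V) :=
    { rIn := 1 / (2 * Real.pi * ϱ) / 2
      rOut := 1 / (2 * Real.pi * ϱ)
      rIn_pos := half_pos hσ
      rIn_lt_rOut := half_lt_self hσ }
  rw [← two_mul_ofReal_observationGain_mul hQ0 hQ_top hγ]
  exact lintegral_enorm_sq_fourierInv_le (φ := φ) hg hr hgr hfin hQm hQ hQ0
    (mul_one_div_cancel (by positivity)).le (two_mul_leakage_le hϱ hr hn) hω
    (mul_pos hγ (ENNReal.toReal_pos hQ0 hQ_top)) hthick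

end Scales

section Cubes

variable {d : ℕ} {a γ : ℝ}

theorem measurableSet_cube (x : EuclideanSpace ℝ (Fin d)) (a : ℝ) : MeasurableSet (cube x a) := by
  simp only [cube, Set.ofPred_forall]
  exact MeasurableSet.iInter fun i =>
    (by fun_prop : Measurable fun y : EuclideanSpace ℝ (Fin d) => y i) measurableSet_Icc

theorem volume_cube (x : EuclideanSpace ℝ (Fin d)) (a : ℝ) :
    volume (cube x a) = ENNReal.ofReal a ^ d := by
  have hpre : cube x a = (MeasurableEquiv.toLp 2 (Fin d → ℝ)).symm ⁻¹'
      (Set.univ.pi fun i => Set.Icc (x i) (x i + a)) := by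
    ext y
    exact (Set.mem_univ_pi (f := y.ofLp)).symm
  rw [hpre, (EuclideanSpace.volume_preserving_symm_measurableEquiv_toLp (Fin d)).measure_preimage
    (MeasurableSet.univ_pi fun _ => measurableSet_Icc).nullMeasurableSet, volume_pi_pi]
  simp only [Real.volume_Icc, add_sub_cancel_left, Finset.prod_const, Finset.card_univ,
    Fintype.card_fin]

theorem measureReal_cube (ha : 0 ≤ a) (x : EuclideanSpace ℝ (Fin d)) :
    volume.real (cube x a) = a ^ d := by
  rw [measureReal_def, volume_cube, ENNReal.toReal_pow, ENNReal.toReal_ofReal ha]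

theorem cube_zero_subset_closedBall (ha : 0 ≤ a) :
    cube (0 : EuclideanSpace ℝ (Fin d)) a ⊆ Metric.closedBall 0 (√d * a) := by
  intro y hy
  rw [mem_closedBall_zero_iff, EuclideanSpace.norm_eq]
  calc √(∑ i, ‖y i‖ ^ 2) ≤ √(∑ _i : Fin d, a ^ 2) := by
        gcongr with i
        obtain ⟨hlower, hupper⟩ := hy i
        rw [PiLp.zero_apply] at hlower hupper
        rw [Real.norm_of_nonneg hlower]
        linarith
    _ = √d * a := by
        rw [Finset.sum_const, Finset.card_univ, Fintype.card_fin, nsmul_eq_mul,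
          Real.sqrt_mul (Nat.cast_nonneg d), Real.sqrt_sq ha]

theorem preimage_add_right_cube (c : EuclideanSpace ℝ (Fin d)) :
    (· + c) ⁻¹' cube c a = cube 0 a := by
  ext x
  simp only [cube, Set.mem_preimage, Set.mem_ofPred_eq, Set.mem_Icc, PiLp.add_apply,
    PiLp.zero_apply, zero_add, add_comm (x _), add_le_add_iff_left,
    le_add_iff_nonneg_right]

theorem IsThick.mul_measureReal_cube_le {ω : Set (EuclideanSpace ℝ (Fin d))} (hω : IsThick γ a ω)
    (ha : 0 ≤ a) (c : EuclideanSpace ℝ (Fin d)) :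
    γ * volume.real (cube (0 : EuclideanSpace ℝ (Fin d)) a) ≤
      volume.real ((· + c) ⁻¹' ω ∩ cube 0 a) := by
  have hfin : volume (ω ∩ cube c a) ≠ ⊤ := by
    refine measure_ne_top_of_subset Set.inter_subset_right ?_
    rw [volume_cube]
    finiteness
  rw [measureReal_cube ha, ← preimage_add_right_cube c, ← Set.preimage_inter, measureReal_def,
    measure_preimage_add_right]
  exact (ENNReal.ofReal_le_iff_le_toReal hfin).1 (hω c)

end Cubes

section Thick

/-- A constant for which the spectral inequality holds in dimension `d`. -/
noncomputable def spectralConst (d : ℕ) : ℝ :=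
  32 * Real.exp 1 ^ 2 + 16 * Real.exp 1 * (4 * √d) ^ d *
    volume.real (Metric.ball (0 : EuclideanSpace ℝ (Fin d)) 1) + (d + 14) * (√d + 1)

theorem spectralConst_pos (d : ℕ) : 0 < spectralConst d := by
  rw [spectralConst]
  positivity

variable {d : ℕ} {a γ : ℝ}

theorem base_le_spectralConst (ha : 0 < a) :
    16 * Real.exp 1 *
      volume.real (Metric.closedBall (0 : EuclideanSpace ℝ (Fin d)) (4 * (√d * a))) /
      volume.real (cube (0 : EuclideanSpace ℝ (Fin d)) a) ≤ spectralConst d := by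
  rw [measureReal_cube ha.le, Measure.addHaar_real_closedBall _ _ (by positivity),
    finrank_euclideanSpace_fin, spectralConst, ← mul_assoc 4, mul_pow _ a]
  set b := volume.real (Metric.ball (0 : EuclideanSpace ℝ (Fin d)) 1)
  calc 16 * Real.exp 1 * ((4 * √d) ^ d * a ^ d * b) / a ^ d
      = 16 * Real.exp 1 * (4 * √d) ^ d * b := by field_simp
    _ ≤ _ := by
      have : 0 ≤ 32 * Real.exp 1 ^ 2 + (d + 14) * (√d + 1) := by positivity
      linarith

theorem ceil_degree_add_one_le {s : ℝ} (hs : 0 ≤ s) :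
    (⌈(d + 12) * (√d * s + 1)⌉₊ + 1 : ℝ) ≤ spectralConst d * (s + 1) := by
  have hceil := Nat.ceil_lt_add_one (by positivity : 0 ≤ (d + 12) * (√d * s + 1))
  have hC : (d + 14) * (√d + 1) ≤ spectralConst d :=
    le_add_of_nonneg_left (by positivity)
  calc (⌈(d + 12) * (√d * s + 1)⌉₊ + 1 : ℝ) ≤ (d + 14) * (√d * s + 1) := by
        have : 0 ≤ √d * s := by positivity
        linarith
    _ ≤ (d + 14) * ((√d + 1) * (s + 1)) := by
        gcongr
        nlinarith [Real.sqrt_nonneg d]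
    _ ≤ spectralConst d * (s + 1) := by
        rw [← mul_assoc]
        gcongr

theorem IsThick.lintegral_enorm_sq_fourierInv_le {H : Type*} [NormedAddCommGroup H]
    [InnerProductSpace ℂ H] [CompleteSpace H] {ω : Set (EuclideanSpace ℝ (Fin d))}
    (hthick : IsThick γ a ω) (hd : 1 ≤ d) (ha : 0 < a) (hγ : 0 < γ) (hγ1 : γ ≤ 1)
    (hω : MeasurableSet ω) {N : ℝ} (hN : 0 ≤ N) {g : EuclideanSpace ℝ (Fin d) → H}
    (hg : Integrable g) (hgN : Function.support g ⊆ Metric.closedBall 0 (N / (2 * Real.pi)))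
    (hfin : ∫⁻ x, ‖𝓕⁻ g x‖ₑ ^ 2 ≠ ⊤) :
    ∫⁻ x, ‖𝓕⁻ g x‖ₑ ^ 2 ≤
      ENNReal.ofReal ((spectralConst d / γ) ^ (spectralConst d * (N * a + 1))) ^ 2 *
        ∫⁻ x in ω, ‖𝓕⁻ g x‖ₑ ^ 2 := by
  have : (0 : ℝ) < d := by exact_mod_cast hd
  have hvol : volume (cube (0 : EuclideanSpace ℝ (Fin d)) a) ≠ 0 := by
    rw [volume_cube]
    exact pow_ne_zero _ (ENNReal.ofReal_pos.2 ha).ne'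
  have hC := spectralConst_pos d
  have hfreq : 2 * Real.pi * (√d * a) * (N / (2 * Real.pi)) = √d * (N * a) := by
    field_simp
  refine (lintegral_enorm_sq_fourierInv_le_of_forall_le_measureReal
    (n := ⌈(d + 12) * (√d * (N * a) + 1)⌉₊) hg (by positivity) hgN hfin (measurableSet_cube 0 a)
    (by positivity) (cube_zero_subset_closedBall ha.le) hvol hω hγ
    (hthick.mul_measureReal_cube_le ha.le) ?_).trans ?_
  · rw [hfreq, finrank_euclideanSpace_fin]
    exact Nat.le_ceil _
  · rw [← ENNReal.ofReal_pow (by positivity)]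
    gcongr
    exact mul_sq_exp_one_mul_pow_le_sq_rpow hγ hγ1 (by positivity) (base_le_spectralConst ha)
      (by rw [spectralConst, add_assoc]; exact le_add_of_nonneg_right (by positivity))
      (ceil_degree_add_one_le (by positivity))

end Thick

section SquareIntegrable

variable {V : Type*} [NormedAddCommGroup V] [InnerProductSpace ℝ V] [FiniteDimensional ℝ V]
  [MeasurableSpace V] [BorelSpace V] {H : Type*} [NormedAddCommGroup H] [InnerProductSpace ℂ H]
  [CompleteSpace H]

theorem integral_fourierInv_smul_eq {φ : V → ℂ} {g : V → H} (hφ : Integrable φ)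
    (hg : Integrable g) : ∫ x, 𝓕⁻ φ x • g x = ∫ x, φ x • 𝓕⁻ g x := by
  have hflip : (-innerₗ V).flip = -innerₗ V := by
    ext x y
    simp only [LinearMap.flip_apply, LinearMap.neg_apply, innerₗ_apply_apply, real_inner_comm]
  have h := VectorFourier.integral_fourierIntegral_smul_eq_flip (L := -innerₗ V)
    Real.continuous_fourierChar (by simpa using! continuous_inner.neg) hφ hg
  rwa [hflip] at h

open scoped ContDiff in
theorem ae_eq_fourierInv (f : Lp H 2 (volume : Measure V)) {g : V → H} (hg : Integrable g)
    (hfg : (𝓕 f : Lp H 2 (volume : Measure V)) =ᵐ[volume] g) : f =ᵐ[volume] 𝓕⁻ g := by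
  refine ae_eq_of_integral_contDiff_smul_eq ((Lp.memLp f).locallyIntegrable one_le_two)
    (continuous_fourierInv hg).locallyIntegrable fun φ hφ hφc => ?_
  let Φ : SchwartzMap V ℂ := HasCompactSupport.toSchwartzMap (f := fun x => (φ x : ℂ))
    (hφc.comp_left Complex.ofReal_zero) (Complex.ofRealCLM.contDiff.comp hφ)
  have hΦ (x : V) (y : H) : φ x • y = Φ x • y := (Complex.coe_smul (φ x) y).symm
  have hinv := congrArg (· Φ) (Lp.fourierInv_toTemperedDistribution_eq (𝓕 f))
  simp only [fourierInv_fourier_eq, TemperedDistribution.fourierInv_apply,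
    Lp.toTemperedDistribution_apply, SchwartzMap.fourierInv_coe] at hinv
  simp only [hΦ]
  rw [← hinv, ← integral_fourierInv_smul_eq Φ.integrable hg]
  refine integral_congr_ae ?_
  filter_upwards [hfg] with x hx
  rw [hx]

theorem exists_integrable_ae_eq_fourierInv {f : Lp H 2 (volume : Measure V)} {r : ℝ}
    (hf : ∀ᵐ ξ, (𝓕 f : Lp H 2 (volume : Measure V)) ξ ≠ 0 → ξ ∈ Metric.closedBall 0 r) :
    ∃ g : V → H, Integrable g ∧ Function.support g ⊆ Metric.closedBall 0 r ∧
      f =ᵐ[volume] 𝓕⁻ g := by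
  set B := Metric.closedBall (0 : V) r
  have : IsFiniteMeasure (volume.restrict B) := ⟨by
    rw [Measure.restrict_apply_univ]
    exact measure_closedBall_lt_top⟩
  set F : Lp H 2 (volume : Measure V) := 𝓕 f
  have hg : Integrable (B.indicator F) :=
    (integrable_indicator_iff measurableSet_closedBall).2
      (((Lp.memLp F).restrict B).integrable one_le_two)
  refine ⟨B.indicator F, hg, Set.support_indicator_subset, ae_eq_fourierInv f hg ?_⟩
  filter_upwards [hf] with ξ hξ
  exact (Set.indicator_apply_eq_self.2 fun hξB => by_contra fun h0 => hξB (hξ h0)).symm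

end SquareIntegrable

section EssSupport

variable {d : ℕ}

theorem ae_mem_of_essSupport_subset {F : EuclideanSpace ℝ (Fin d) → ℂ}
    {K : Set (EuclideanSpace ℝ (Fin d))} (hF : essSupport F ⊆ K) : ∀ᵐ ξ, F ξ ≠ 0 → ξ ∈ K := by
  rw [ae_iff]
  refine measure_null_of_locally_null _ fun ξ hξ => ?_
  rw [Set.mem_ofPred_eq, Classical.not_imp] at hξ
  have hξ' := mt (@hF ξ) hξ.2
  simp only [essSupport, Set.mem_ofPred_eq, not_forall, not_not] at hξ'
  obtain ⟨U, hU, hU0⟩ := hξ'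
  refine ⟨_, Filter.inter_mem (mem_nhdsWithin_of_mem_nhds hU) self_mem_nhdsWithin,
    measure_mono_null ?_ hU0⟩
  exact fun η ⟨hηU, hη⟩ => ⟨hηU, (Classical.not_imp.1 hη).1⟩

theorem ae_fourier_mem_closedBall {f : Lp ℂ 2 (volume : Measure (EuclideanSpace ℝ (Fin d)))}
    {N : ℝ} (hf : essSupport (fourierHat f) ⊆ Metric.closedBall 0 N) :
    ∀ᵐ ξ, (𝓕 f : Lp ℂ 2 (volume : Measure (EuclideanSpace ℝ (Fin d)))) ξ ≠ 0 →
      ξ ∈ Metric.closedBall 0 (N / (2 * Real.pi)) := by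
  have h := (Measure.quasiMeasurePreserving_smul
    (volume : Measure (EuclideanSpace ℝ (Fin d))) Real.two_pi_pos.ne').ae
    (ae_mem_of_essSupport_subset hf)
  filter_upwards [h] with ξ hξ hξ0
  rw [fourierHat, inv_smul_smul₀ Real.two_pi_pos.ne', mem_closedBall_zero_iff, norm_smul,
    Real.norm_of_nonneg Real.two_pi_pos.le] at hξ
  rw [mem_closedBall_zero_iff, le_div_iff₀' Real.two_pi_pos]
  exact hξ hξ0

end EssSupport

theorem IsThick.congr_ae {d : ℕ} {γ a : ℝ} {ω ω' : Set (EuclideanSpace ℝ (Fin d))}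
    (hω : IsThick γ a ω) (h : ω =ᵐ[volume] ω') : IsThick γ a ω' := fun x => by
  rw [← measure_congr (h.inter (Filter.EventuallyEq.refl _ (cube x a)))]
  exact hω x

theorem eLpNorm_two_sq_eq_lintegral {α E : Type*} [MeasurableSpace α] [NormedAddCommGroup E]
    (μ : Measure α) (f : α → E) : eLpNorm f 2 μ ^ 2 = ∫⁻ x, ‖f x‖ₑ ^ 2 ∂μ := by
  simpa using eLpNorm_nnreal_pow_eq_lintegral (f := f) (μ := μ) two_ne_zero

end LogvinenkoSereda

theorem mainTheorem6 (d : ℕ) (hd : 1 ≤ d) :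
    ∃ C : ℝ, 0 < C ∧
      ∀ γ : ℝ, 0 < γ → γ ≤ 1 →
      ∀ a : ℝ, 0 < a →
      ∀ ω : Set (EuclideanSpace ℝ (Fin d)), NullMeasurableSet ω volume →
        LogvinenkoSereda.IsThick γ a ω →
      ∀ N : ℝ, 0 ≤ N →
      ∀ f : Lp ℂ 2 (volume : Measure (EuclideanSpace ℝ (Fin d))),
        LogvinenkoSereda.essSupport (LogvinenkoSereda.fourierHat f) ⊆ Metric.closedBall 0 N →
        eLpNorm f 2 volume ≤
          ENNReal.ofReal ((C / γ) ^ (C * (N * a + 1))) * eLpNorm f 2 (volume.restrict ω) := by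
  refine ⟨LogvinenkoSereda.spectralConst d, LogvinenkoSereda.spectralConst_pos d,
    fun γ hγ hγ1 a ha ω hω hthick N hN f hf => ?_⟩
  obtain ⟨ω', -, hω', hωω'⟩ := hω.exists_measurable_superset_ae_eq
  obtain ⟨g, hg, hgN, hfg⟩ := LogvinenkoSereda.exists_integrable_ae_eq_fourierInv
    (LogvinenkoSereda.ae_fourier_mem_closedBall hf)
  have hfin : ∫⁻ x, ‖𝓕⁻ g x‖ₑ ^ 2 ≠ ⊤ := by
    rw [← LogvinenkoSereda.eLpNorm_two_sq_eq_lintegral, ← eLpNorm_congr_ae hfg]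
    exact ENNReal.pow_ne_top (Lp.eLpNorm_ne_top f)
  have hsq := (hthick.congr_ae hωω'.symm).lintegral_enorm_sq_fourierInv_le hd ha hγ hγ1 hω' hN hg
    hgN hfin
  rw [← LogvinenkoSereda.eLpNorm_two_sq_eq_lintegral,
    ← LogvinenkoSereda.eLpNorm_two_sq_eq_lintegral, ← eLpNorm_congr_ae hfg,
    ← eLpNorm_congr_ae (ae_restrict_of_ae hfg), Measure.restrict_congr_set hωω', ← mul_pow] at hsq
  exact (ENNReal.pow_le_pow_left_iff two_ne_zero).1 hsq
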